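/- For a graph $G=(V,E)$ and an integer $r\ge 2$, an $r$-coloring of $G$ is an arbitrary map $E\to\{1,\dots,r\}$. Let $K_3^{(2)}$ be the pattern of the triangle $K_3$ in which the edge set is partitioned into two classes, one with two edges and one with a single edge. An $r$-coloring of $G$ is $K_3^{(2)}$-free if no triangle of $G$ has edges in exactly two colors, and $c_{r,K_3^{(2)}}(G)$ denotes the number of $K_3^{(2)}$-free $r$-colorings of $G$. Let $\mathrm{ex}(n,K_3)$ be the maximum number of edges of a triangle-free graph on $n$ vertices and, for $W\subseteq V$, let $e_G(W)$ be the number of edges of the subgraph of $G$ induced by $W$. **Lemma.** Let $2\le r\le 26$ be an integer. For any fixed real $\delta>0$, there exists $n_0$ such that the following holds for all $n\ge n_0$. If $G=(V,E)$ is an $n$-vertex graph such that $$c_{r,K_3^{(2)}}(G)\ \ge\ r^{\mathrm{ex}(n,K_3)},$$ then there is a partition $V=W_1\cup W_2$ of its vertex set into two nonempty classes such that $e_G(W_1)+e_G(W_2)\le \delta n^2$. -/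

import Mathlib

namespace EdgePattern

/-- A pattern of a graph `F`: a partition of the edge set of `F`, given as an equivalence relation
on the edges whose classes are the parts. -/
abbrev Pattern {U : Type*} (F : SimpleGraph U) : Type _ :=
  Setoid F.edgeSet

/-- The edge-coloring `c` of `G` is `P`-free: there is no copy of `F` in `G` on which `c` induces
the partition `P`. A copy is an injective homomorphism `f : F → G`; since `f` ranges over all
labelings of every subgraph isomorphic to `F`, equality of the pulled-back partition
("same color") with `P` for some `f` says that the induced partition is isomorphic to `P`. -/
def IsPatternFree {U V K : Type*} {F : SimpleGraph U} {G : SimpleGraph V}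
    (P : Pattern F) (c : G.EdgeLabeling K) : Prop :=
  ∀ f : SimpleGraph.Copy F G, Setoid.ker (fun e : F.edgeSet => c (f.mapEdgeSet e)) ≠ P

/-- `c_{r,P}(G)`: the number of `P`-free `r`-edge-colorings of `G`. -/
noncomputable def numPatternFree {U V : Type*} {F : SimpleGraph U} (r : ℕ) (P : Pattern F)
    (G : SimpleGraph V) : ℕ :=
  Nat.card {c : G.EdgeLabeling (Fin r) // IsPatternFree P c}

/-- The triangle `K₃`. -/
abbrev triangle : SimpleGraph (Fin 3) := ⊤

/-- The pattern `K₃⁽²⁾` of the triangle with two classes: one consists of the single edge `{0, 1}`,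
the other of the two remaining edges. -/
abbrev triangleTwo : Pattern triangle :=
  Setoid.ker (fun e : triangle.edgeSet => (e : Sym2 (Fin 3)) = s(0, 1))

/-- `e_G(W)`: the number of edges of the subgraph of `G` induced by `W`. -/
noncomputable def edgesInside {V : Type*} (G : SimpleGraph V) (W : Set V) : ℕ :=
  Nat.card (G.induce W).edgeSet

end EdgePattern

namespace EdgePattern

/-! ### A weighted Turán inequality by the method of Motzkin and Straus. -/

/-- If the weights of the edges of a triangle are at most `M` and their sum is at most `2 M`, then
the quadratic form is at most the one of a single edge of weight `M`. -/
theorem triangle_form_le {a b c M x y z : ℝ} (hx : 0 ≤ x) (hy : 0 ≤ y) (hz : 0 ≤ z)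
    (ha : a ≤ M) (hb : b ≤ M) (hc : c ≤ M) (hs : a + b + c ≤ 2 * M) (hM : 0 ≤ M) :
    2 * (a * (x * y) + b * (x * z) + c * (y * z)) ≤ M / 2 * (x + y + z) ^ 2 := by
  -- With x the largest variable and c raised to 2M - a - b, the right side minus the left side is
  -- M/2 (x - y - z)² + 2(M - a) y(x - z) + 2(M - b) z(x - y).
  have key : ∀ {a b c x y z : ℝ}, 0 ≤ x → 0 ≤ y → 0 ≤ z → a ≤ M → b ≤ M → c ≤ M →
      a + b + c ≤ 2 * M → y ≤ x → z ≤ x →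
      2 * (a * (x * y) + b * (x * z) + c * (y * z)) ≤ M / 2 * (x + y + z) ^ 2 := by
    intro a b c x y z hx hy hz ha hb hc hs hyx hzx
    have h1 : c * (y * z) ≤ (2 * M - a - b) * (y * z) := by
      apply mul_le_mul_of_nonneg_right (by linarith) (by positivity)
    have h2 : 0 ≤ (M - a) * (y * (x - z)) :=
      mul_nonneg (by linarith) (mul_nonneg hy (by linarith))
    have h3 : 0 ≤ (M - b) * (z * (x - y)) :=
      mul_nonneg (by linarith) (mul_nonneg hz (by linarith))
    nlinarith [mul_nonneg hM (sq_nonneg (x - y - z))]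
  rcases le_total x y with h | h
  · rcases le_total y z with h' | h'
    · have := @key b c a z x y hz hx hy hb hc ha (by linarith) (by linarith) (by linarith)
      nlinarith [this]
    · have := @key a c b y x z hy hx hz ha hc hb (by linarith) (by linarith) (by linarith)
      nlinarith [this]
  · rcases le_total x z with h' | h'
    · have := @key b c a z x y hz hx hy hb hc ha (by linarith) (by linarith) (by linarith)
      nlinarith [this]
    · exact key hx hy hz ha hb hc hs h h'

section Quadratic

variable {κ : Type*} [Fintype κ] [DecidableEq κ]

open Finset Matrix

theorem toBilin'_comm_of_symm {W : Matrix κ κ ℝ} (hW : ∀ i j, W i j = W j i) (x y : κ → ℝ) :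
    toBilin' W x y = toBilin' W y x := by
  simp only [toBilin'_apply]
  rw [sum_comm]
  refine sum_congr rfl fun i _ => sum_congr rfl fun j _ => ?_
  rw [hW]; ring

theorem toBilin'_add_smul_self {W : Matrix κ κ ℝ} (hW : ∀ i j, W i j = W j i) (x d : κ → ℝ)
    (t : ℝ) :
    toBilin' W (x + t • d) (x + t • d) =
      toBilin' W x x + 2 * t * toBilin' W d x + t ^ 2 * toBilin' W d d := by
  simp only [map_add, map_smul, LinearMap.add_apply, LinearMap.smul_apply, smul_eq_mul]
  rw [toBilin'_comm_of_symm hW x d]; ring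

/-- A weighted Turán theorem in the style of Motzkin and Straus: if the weights on each clique have
average degree at most half the size of the clique (or fit on a triangle), then the quadratic form
is at most the one of a single edge. -/
theorem toBilin'_self_le {W : Matrix κ κ ℝ} {M : ℝ} (hM : 0 ≤ M)
    (hW : ∀ i j, W i j = W j i) (h0 : ∀ i, W i i = 0)
    (hK : ∀ K : Finset κ, (∀ i ∈ K, ∀ j ∈ K, i ≠ j → W i j ≠ 0) →
      (∀ j ∈ K, ∑ i ∈ K, W i j ≤ #K * M / 2) ∨
      ∃ a b c, a ≠ b ∧ a ≠ c ∧ b ≠ c ∧ K = {a, b, c} ∧ W a b ≤ M ∧ W a c ≤ M ∧ W b c ≤ M ∧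
        W a b + W a c + W b c ≤ 2 * M)
    (x : κ → ℝ) (hx : ∀ i, 0 ≤ x i) :
    toBilin' W x x ≤ M / 2 * (∑ i, x i) ^ 2 := by
  induction hn : #{i | x i ≠ 0} using Nat.strong_induction_on generalizing x with
  | _ n ih =>
  set K : Finset κ := {i | x i ≠ 0} with hKdef
  have memK : ∀ i, i ∈ K ↔ x i ≠ 0 := by simp [hKdef]
  by_cases hc : ∀ i ∈ K, ∀ j ∈ K, i ≠ j → W i j ≠ 0
  · rcases K.eq_empty_or_nonempty with he | hne
    · have : x = 0 := by
        ext i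
        by_contra h
        have := (memK i).2 h
        simp [he] at this
      subst this
      simp
    rcases hK K hc with h | ⟨a, b, c, hab, hac, hbc, hKe, h1, h2, h3, h4⟩
    -- Subtract the minimum t from every coordinate in the clique K. The remainder y has smaller
    -- support, and the degree bound controls the cross term and the form at the indicator d, so the
    -- three bounds add up to M/2 (Σ y + t #K)².
    · obtain ⟨m, hmK, hm⟩ := K.exists_min_image x hne
      set t := x m with ht
      set d : κ → ℝ := fun i => if i ∈ K then 1 else 0 with hd
      set y : κ → ℝ := fun i => x i - t * d i with hy
      have hxy : x = y + t • d := by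
        ext i; simp [hy]
      have ht0 : 0 ≤ t := hx m
      have hyK : ∀ i, i ∉ K → y i = 0 := by
        intro i hi
        have : x i = 0 := by by_contra h'; exact hi ((memK i).2 h')
        simp [hy, hd, hi, this]
      have hy0 : ∀ i, 0 ≤ y i := by
        intro i
        by_cases hi : i ∈ K
        · have := hm i hi
          simp [hy, hd, hi]; linarith
        · rw [hyK i hi]
      have hsub : #{i | y i ≠ 0} < n := by
        rw [← hn]
        apply card_lt_card
        rw [ssubset_iff_of_subset]
        · exact ⟨m, hmK, by simp [hy, hd, hmK, ht]⟩
        · intro i hi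
          by_contra h'
          simp [hyK i h'] at hi
      have key := ih _ hsub y hy0 rfl
      have hdv : ∀ v : κ → ℝ, (∀ i, 0 ≤ v i) → (∀ i, i ∉ K → v i = 0) →
          toBilin' W d v ≤ #K * M / 2 * ∑ i, v i := by
        intro v hv hvK
        rw [toBilin'_apply, sum_comm, mul_sum]
        refine sum_le_sum fun j _ => ?_
        by_cases hj : j ∈ K
        · have e : ∑ i, d i * W i j * v j = (∑ i ∈ K, W i j) * v j := by
            simp [hd, sum_mul]
          rw [e]
          exact mul_le_mul_of_nonneg_right (h j hj) (hv j)
        · simp [hvK j hj]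
      have hsd : ∑ i, d i = #K := by simp [hd]
      have h1 := hdv y hy0 hyK
      have h2 := hdv d (fun i => by simp only [hd]; split_ifs <;> norm_num)
        (fun i hi => by simp [hd, hi])
      have hsx : ∑ i, x i = ∑ i, y i + t * #K := by
        rw [← hsd, mul_sum, ← sum_add_distrib]; simp [hy]
      rw [hsx]
      conv_lhs => rw [hxy]
      rw [toBilin'_add_smul_self hW]
      rw [hsd] at h2
      have h3 := mul_le_mul_of_nonneg_left h1 (by positivity : 0 ≤ 2 * t)
      have h4 := mul_le_mul_of_nonneg_left h2 (by positivity : 0 ≤ t ^ 2)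
      nlinarith
    · have hx3 : ∀ f : κ → ℝ, (∀ i, i ∉ K → f i = 0) → ∑ i, f i = f a + f b + f c := by
        intro f hf
        rw [← sum_subset (subset_univ K) (fun i _ hi => hf i hi), hKe, sum_insert (by simp [hab, hac]),
          sum_insert (by simp [hbc]), sum_singleton]
        ring
      have hxK : ∀ i, i ∉ K → x i = 0 := fun i hi => by
        by_contra h'; exact hi ((memK i).2 h')
      rw [hx3 x hxK, toBilin'_apply, hx3 _ (fun i hi => by simp [hxK i hi]),
        hx3 _ (fun i hi => by simp [hxK i hi]), hx3 _ (fun i hi => by simp [hxK i hi]),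
        hx3 _ (fun i hi => by simp [hxK i hi]), h0, h0, h0, hW b a, hW c a, hW c b]
      have := triangle_form_le (hx a) (hx b) (hx c) h1 h2 h3 h4 hM
      linarith
  · push Not at hc
    obtain ⟨i, hi, j, hj, hij, hw⟩ := hc
    -- Since `W i j = 0`, moving mass from j to i changes the form linearly. In the better of the
    -- two directions the form does not decrease, and moving all the mass removes a point of the
    -- support.
    wlog hg : toBilin' W (Pi.single j 1) x ≤ toBilin' W (Pi.single i 1) x generalizing i j
    · exact this j hj i hi hij.symm (by rw [hW, hw]) (le_of_not_ge hg)
    set d : κ → ℝ := Pi.single i 1 - Pi.single j 1 with hd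
    have hd1 : ∑ k, d k = 0 := by simp [hd]
    have hBd : toBilin' W d d = 0 := by
      simp only [hd, map_sub, LinearMap.sub_apply, toBilin'_single, h0, hW j i, hw]; ring
    have e := toBilin'_add_smul_self hW x d (x j)
    have hv : ∀ k, (x + x j • d) k = if k = i then x i + x j else if k = j then 0 else x k := by
      intro k
      by_cases hki : k = i
      · subst hki; simp [hd, hij]
      · by_cases hkj : k = j
        · subst hkj; simp [hd, hki]
        · simp [hd, hki, hkj]
    have hnn : ∀ k, 0 ≤ (x + x j • d) k := by
      intro k
      rw [hv]
      split_ifs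
      · exact add_nonneg (hx i) (hx j)
      · exact le_rfl
      · exact hx k
    have hlt : #{k | (x + x j • d) k ≠ 0} < n := by
      rw [← hn]
      apply card_lt_card
      rw [ssubset_iff_of_subset]
      · exact ⟨j, hj, by rw [mem_filter, hv]; simp [hij.symm]⟩
      · intro k hk
        rw [mem_filter, hv] at hk
        rw [memK]
        by_cases hki : k = i
        · subst hki; exact (memK k).1 hi
        · by_cases hkj : k = j
          · subst hkj; exact (memK k).1 hj
          · simpa [hki, hkj] using hk
    have key := ih _ hlt _ hnn rfl
    have hs : ∑ k, (x + x j • d) k = ∑ k, x k := by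
      simp only [Pi.add_apply, Pi.smul_apply, smul_eq_mul, sum_add_distrib, ← mul_sum, hd1]; ring
    rw [hs] at key
    have : 0 ≤ toBilin' W d x := by
      simp only [hd, map_sub, LinearMap.sub_apply]; linarith
    nlinarith [mul_nonneg (hx j) this]

end Quadratic

end EdgePattern

namespace EdgePattern

open Finset Real

/-! ### Numerical estimates for list sizes. -/

/-- The weight of a pair whose list has `s` of the `r` colors: `log s`, plus a bonus if the list is
neither empty nor full. -/
noncomputable def listWeight (r s : ℕ) : ℝ :=
  if s = 0 then 0 else if s = r then log r else log s + 1 / 100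

@[simp]
theorem listWeight_zero (r : ℕ) : listWeight r 0 = 0 := by simp [listWeight]

/-- The gap 1/26 between a full and a partial list exceeds the bonus 1/100 of `listWeight`. -/
theorem log_natCast_add_le {r s : ℕ} (hr : r ≤ 26) (hs : 1 ≤ s) (hsr : s < r) :
    log s + 1 / 26 ≤ log r := by
  have hs' : (0 : ℝ) < s := by exact_mod_cast hs
  have hr' : (0 : ℝ) < r := by exact_mod_cast (by omega : 0 < r)
  have h := log_le_sub_one_of_pos (div_pos hs' hr')
  rw [log_div hs'.ne' hr'.ne'] at h
  have h1 : (s : ℝ) + 1 ≤ r := by exact_mod_cast hsr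
  have h2 : (r : ℝ) ≤ 26 := by exact_mod_cast hr
  have h3 : (s : ℝ) / r ≤ 1 - 1 / 26 := by
    rw [div_le_iff₀ hr']; nlinarith
  linarith

theorem log_natCast_ge {r : ℕ} (hr : 2 ≤ r) : 1 / 2 ≤ log r := by
  have h : log 2 ≤ log r := log_le_log (by norm_num) (by exact_mod_cast hr)
  linarith [log_two_gt_d9]

theorem listWeight_le {r s : ℕ} (h2 : 2 ≤ r) (hr : r ≤ 26) (hs : s ≤ r) :
    listWeight r s ≤ log r := by
  unfold listWeight
  split_ifs with h h'
  · linarith [log_natCast_ge h2]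
  · exact le_rfl
  · linarith [log_natCast_add_le hr (Nat.pos_of_ne_zero h) (lt_of_le_of_ne hs h')]

theorem listWeight_of_lt {r s : ℕ} (hs : 1 ≤ s) (hsr : s < r) :
    listWeight r s = log s + 1 / 100 := by
  rw [listWeight, if_neg (by omega), if_neg (by omega)]

/-- Tangent line of the logarithm at r/3, the list size in the critical case of three equal disjoint
lists. -/
theorem log_natCast_le_tangent {r s : ℕ} (hr : 1 ≤ r) (hs : 1 ≤ s) :
    log s ≤ log r - log 3 - 1 + 3 / r * s := by
  have hs' : (0 : ℝ) < s := by exact_mod_cast hs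
  have hr' : (0 : ℝ) < r := by exact_mod_cast hr
  have h := log_le_sub_one_of_pos (x := 3 / r * s) (by positivity)
  rw [log_mul (by positivity) hs'.ne', log_div (by norm_num) hr'.ne'] at h
  linarith

/-- This is r < 27 in quantitative form; the slack 3/100 pays for the bonuses of three partial
lists. -/
theorem log_natCast_le_log_three {r : ℕ} (h2 : 2 ≤ r) (hr : r ≤ 26) :
    log r + 3 / 100 ≤ 3 * log 3 := by
  have hr' : (0 : ℝ) < r := by exact_mod_cast (by omega : 0 < r)
  have h := log_le_sub_one_of_pos (x := r / 3 ^ 3) (by positivity)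
  rw [log_div hr'.ne' (by norm_num), log_pow] at h
  have h2 : (r : ℝ) ≤ 26 := by exact_mod_cast hr
  have h3 : (r : ℝ) / 3 ^ 3 ≤ 26 / 27 := by norm_num; linarith
  push_cast at h
  linarith

theorem log_three_lt : log 3 < 6 / 5 := by
  have h : log (3 / 2) ≤ 3 / 2 - 1 := log_le_sub_one_of_pos (by norm_num)
  rw [log_div (by norm_num) (by norm_num)] at h
  linarith [log_two_lt_d9]

theorem sum_log_le_tangent {ι : Type*} {r : ℕ} (h2 : 2 ≤ r) (T : Finset ι) (s : ι → ℕ)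
    (hs : ∀ i ∈ T, 1 ≤ s i) (hsum : ∑ i ∈ T, s i ≤ r) :
    ∑ i ∈ T, log (s i) ≤ #T * (log r - log 3 - 1) + 3 := by
  have hr' : (0 : ℝ) < r := by exact_mod_cast (by omega : 0 < r)
  calc ∑ i ∈ T, log (s i) ≤ ∑ i ∈ T, (log r - log 3 - 1 + 3 / r * s i) :=
        sum_le_sum fun i hi => log_natCast_le_tangent (by omega) (hs i hi)
    _ = #T * (log r - log 3 - 1) + 3 / r * ((∑ i ∈ T, s i : ℕ) : ℝ) := by
        rw [sum_add_distrib, sum_const, nsmul_eq_mul, ← mul_sum, Nat.cast_sum]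
    _ ≤ #T * (log r - log 3 - 1) + 3 / r * (r : ℝ) := by
        gcongr
    _ = _ := by rw [div_mul_cancel₀ _ hr'.ne']

/-- Here T stands for the neighbors of a vertex of a k-clique whose lists are not singletons, and (k
- 1)/100 is the total bonus at that vertex. -/
theorem sum_log_star_le {ι : Type*} {r k : ℕ} (h2 : 2 ≤ r) (hr : r ≤ 26) (T : Finset ι)
    (s : ι → ℕ) (hs : ∀ i ∈ T, 1 ≤ s i) (hs' : ∀ i ∈ T, s i < r) (hsum : ∑ i ∈ T, s i ≤ r)
    (hT : #T + 1 ≤ k) (hk : 4 ≤ k) :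
    ∑ i ∈ T, log (s i) + (k - 1) / 100 ≤ k * log r / 2 := by
  have hk' : (4 : ℝ) ≤ k := by exact_mod_cast hk
  have hT' : (#T : ℝ) + 1 ≤ k := by exact_mod_cast hT
  have hlr := log_natCast_ge h2
  have hl3 := log_natCast_le_log_three h2 hr
  have hl3' := log_three_lt
  -- For at most two lists the gap 1/26 suffices because k ≥ 4. For three lists the tangent bound
  -- gives 3 log (r/3) ≤ 2 log r - 3/100, and each further list adds at most log r / 2 - 1/100.
  rcases Nat.lt_or_ge (#T) 3 with h | h
  · have hT2 : (#T : ℝ) ≤ 2 := by exact_mod_cast (by omega : #T ≤ 2)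
    have : ∑ i ∈ T, log (s i) ≤ #T * (log r - 1 / 26) := by
      rw [← nsmul_eq_mul, ← sum_const]
      refine sum_le_sum fun i hi => ?_
      linarith [log_natCast_add_le hr (hs i hi) (hs' i hi)]
    nlinarith
  · have h3 : (3 : ℝ) ≤ #T := by exact_mod_cast h
    have := sum_log_le_tangent h2 T s hs hsum
    have h4 : log r - log 3 - 1 ≤ log r / 2 - 1 / 100 := by linarith
    have h5 := mul_le_mul_of_nonneg_left h4 (by linarith : 0 ≤ (#T : ℝ) - 3)
    have h6 := mul_le_mul_of_nonneg_right (by linarith : (#T : ℝ) - 3 ≤ k - 4)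
      (by linarith : 0 ≤ log r / 2 - 1 / 100)
    linarith

/-! ### Pattern-free lists on cliques. -/

section Lists

variable {κ : Type*} {r : ℕ}

/-- A choice of a list of colors for each pair is pattern-free on distinct vertices `i, j, k` if no
color common to `ij` and `jk` can be completed by a different color of `ik`. -/
def IsPatternFreeAt (L : κ → κ → Finset (Fin r)) (i j k : κ) : Prop :=
  ∀ a b, a ∈ L i j → a ∈ L j k → b ∈ L i k → a = b

variable {L : κ → κ → Finset (Fin r)} (hsymm : ∀ i j, L i j = L j i)
  (hfree : ∀ i j k, i ≠ j → j ≠ k → i ≠ k → IsPatternFreeAt L i j k)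

include hsymm hfree

/-- A color shared by two sides of a triangle is the only one possible on the third; being then
shared by every two sides, it is the only one on each of them. -/
theorem lists_eq_singleton {i j k : κ} (hij : i ≠ j) (hjk : j ≠ k) (hik : i ≠ k)
    (hne : (L i k).Nonempty) {a : Fin r} (h1 : a ∈ L i j) (h2 : a ∈ L j k) :
    L i j = {a} ∧ L j k = {a} ∧ L i k = {a} := by
  have h3 : L i k = {a} := by
    rw [eq_singleton_iff_nonempty_unique_mem]
    exact ⟨hne, fun b hb => (hfree i j k hij hjk hik a b h1 h2 hb).symm⟩
  have h4 : a ∈ L i k := by simp [h3]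
  refine ⟨?_, ?_, h3⟩
  · rw [eq_singleton_iff_unique_mem]
    exact ⟨h1, fun b hb => (hfree i k j hik hjk.symm hij a b h4 (hsymm j k ▸ h2) hb).symm⟩
  · rw [eq_singleton_iff_unique_mem]
    exact ⟨h2, fun b hb => (hfree j i k hij.symm hik hjk a b (hsymm i j ▸ h1) h4 hb).symm⟩

theorem card_list_lt {i j k : κ} (hr : 2 ≤ r) (hij : i ≠ j) (hjk : j ≠ k) (hik : i ≠ k)
    (hne : (L i k).Nonempty) (hne' : (L j k).Nonempty) : #(L i j) < r := by
  by_contra h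
  have hu : L i j = univ := by
    rw [← card_eq_iff_eq_univ, Fintype.card_fin]
    exact le_antisymm (by simpa using card_le_univ (L i j)) (not_lt.1 h)
  obtain ⟨a, ha⟩ := hne'
  have := (lists_eq_singleton hsymm hfree hij hjk hik hne (by simp [hu]) ha).1
  rw [this, card_singleton] at h
  omega

/-- By `lists_eq_singleton`, the lists at j that are not singletons are pairwise disjoint, so their
sizes add up to at most r; singletons contribute only their bonus. -/
theorem sum_listWeight_star_le [DecidableEq κ] (h2 : 2 ≤ r) (hr : r ≤ 26) {K : Finset κ}
    (hK : ∀ i ∈ K, ∀ j ∈ K, i ≠ j → (L i j).Nonempty) (hcard : 4 ≤ #K) {j : κ} (hj : j ∈ K) :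
    ∑ i ∈ K.erase j, listWeight r #(L i j) ≤ #K * log r / 2 := by
  have hlt : ∀ i ∈ K.erase j, #(L i j) < r := by
    intro i hi
    obtain ⟨k, hk⟩ : ((K.erase j).erase i).Nonempty := by
      rw [← card_pos, card_erase_of_mem hi, card_erase_of_mem hj]; omega
    simp only [mem_erase] at hi hk
    exact card_list_lt hsymm hfree h2 hi.1 hk.2.1.symm hk.1.symm
      (hK i hi.2 k hk.2.2 hk.1.symm) (hK j hj k hk.2.2 hk.2.1.symm)
  have hpos : ∀ i ∈ K.erase j, 1 ≤ #(L i j) := fun i hi => by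
    simp only [mem_erase] at hi
    exact card_pos.2 (hK i hi.2 j hj hi.1)
  set T := (K.erase j).filter fun i => #(L i j) ≠ 1 with hT
  have hsum : ∑ i ∈ T, #(L i j) ≤ r := by
    rw [← card_biUnion]
    · simpa using card_le_univ (T.biUnion fun i => L i j)
    · intro i hi k hk hik
      change Disjoint (L i j) (L k j)
      rw [Finset.disjoint_left]
      intro a ha ha'
      simp only [hT, mem_coe, mem_filter, mem_erase] at hi hk
      have := (lists_eq_singleton hsymm hfree hi.1.1 hk.1.1.symm hik (hK i hi.1.2 k hk.1.2 hik) ha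
        (hsymm k j ▸ ha')).1
      exact hi.2 (by rw [this, card_singleton])
  have hTc : #T + 1 ≤ #K := by
    have h1 : #T ≤ #(K.erase j) := card_filter_le _ _
    rw [card_erase_of_mem hj] at h1; omega
  have hs := sum_log_star_le h2 hr T (fun i => #(L i j))
    (fun i hi => hpos i (mem_filter.1 hi).1) (fun i hi => hlt i (mem_filter.1 hi).1) hsum hTc hcard
  have e1 : ∑ i ∈ K.erase j, listWeight r #(L i j) =
      ∑ i ∈ K.erase j, log #(L i j) + (#K - 1) / 100 := by
    rw [sum_congr rfl fun i hi => listWeight_of_lt (hpos i hi) (hlt i hi), sum_add_distrib,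
      sum_const, card_erase_of_mem hj, nsmul_eq_mul, Nat.cast_sub (by omega)]
    push_cast; ring
  have e2 : ∑ i ∈ K.erase j, log #(L i j) = ∑ i ∈ T, log #(L i j) := by
    rw [hT, sum_filter]
    refine sum_congr rfl fun i _ => ?_
    split_ifs with h
    · rfl
    · simp [not_not.1 h]
  rw [e1, e2]; exact hs

/-- Either all three lists are the same singleton or they are disjoint with total size at most r.
Triangles need this separate bound because the degree bound fails for them: for r = 26 and disjoint
lists of sizes 12, 13, 1, log 12 + log 13 > (3/2) log 26. -/
theorem sum_listWeight_triangle_le (h2 : 2 ≤ r) (hr : r ≤ 26) {a b c : κ}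
    (hab : a ≠ b) (hac : a ≠ c) (hbc : b ≠ c) (h1 : (L a b).Nonempty) (h2' : (L a c).Nonempty)
    (h3 : (L b c).Nonempty) :
    listWeight r #(L a b) + listWeight r #(L a c) + listWeight r #(L b c) ≤ 2 * log r := by
  classical
  have hlr := log_natCast_ge h2
  have l1 := card_list_lt hsymm hfree h2 hab hbc hac h2' h3
  have l2 := card_list_lt hsymm hfree h2 hac hbc.symm hab h1 (hsymm b c ▸ h3)
  have l3 := card_list_lt hsymm hfree h2 hbc hac.symm hab.symm (hsymm a b ▸ h1) (hsymm a c ▸ h2')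
  rw [listWeight_of_lt (card_pos.2 h1) l1, listWeight_of_lt (card_pos.2 h2') l2,
    listWeight_of_lt (card_pos.2 h3) l3]
  have mono : (∃ x, L a b = {x} ∧ L b c = {x} ∧ L a c = {x}) →
      log #(L a b) + 1 / 100 + (log #(L a c) + 1 / 100) + (log #(L b c) + 1 / 100) ≤ 2 * log r := by
    rintro ⟨x, e1, e2, e3⟩
    simp only [e1, e2, e3, card_singleton, Nat.cast_one, log_one]
    linarith
  by_cases d1 : Disjoint (L a b) (L b c)
  · by_cases d2 : Disjoint (L b c) (L a c)
    · by_cases d3 : Disjoint (L a b) (L a c)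
      · have hs : #(L a b) + #(L b c) + #(L a c) ≤ r := by
          rw [← card_union_of_disjoint d1, ← card_union_of_disjoint (disjoint_union_left.2 ⟨d3, d2⟩)]
          simpa using card_le_univ (L a b ∪ L b c ∪ L a c)
        have := sum_log_le_tangent h2 (univ : Finset (Fin 3))
          ![#(L a b), #(L b c), #(L a c)]
          (by intro i _; fin_cases i <;> simp [h1, h2', h3])
          (by simpa [Fin.sum_univ_three] using hs)
        simp only [Fin.sum_univ_three, card_univ, Fintype.card_fin] at this
        have hl3 := log_natCast_le_log_three h2 hr
        simp at this
        linarith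
      · obtain ⟨x, hx, hx'⟩ := not_disjoint_iff.1 d3
        obtain ⟨e1, e2, e3⟩ := lists_eq_singleton hsymm hfree hab.symm hac hbc h3
          (hsymm a b ▸ hx) hx'
        exact mono ⟨x, hsymm a b ▸ e1, e3, e2⟩
    · obtain ⟨x, hx, hx'⟩ := not_disjoint_iff.1 d2
      obtain ⟨e1, e2, e3⟩ := lists_eq_singleton hsymm hfree hbc hac.symm hab.symm (hsymm a b ▸ h1) hx
        (hsymm a c ▸ hx')
      exact mono ⟨x, hsymm a b ▸ e3, e1, hsymm a c ▸ e2⟩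
  · obtain ⟨x, hx, hx'⟩ := not_disjoint_iff.1 d1
    exact mono ⟨x, lists_eq_singleton hsymm hfree hab hbc hac h2' hx hx'⟩

/-- The weighted Turán bound for pattern-free choices of lists. -/
theorem sum_listWeight_le [Fintype κ] [DecidableEq κ] (h2 : 2 ≤ r) (hr : r ≤ 26) :
    ∑ i, ∑ j, (if i = j then 0 else listWeight r #(L i j)) ≤
      log r / 2 * (Fintype.card κ : ℝ) ^ 2 := by
  set W : Matrix κ κ ℝ := fun i j => if i = j then 0 else listWeight r #(L i j) with hW
  have hlr := log_natCast_ge h2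
  have hle : ∀ i j, listWeight r #(L i j) ≤ log r := fun i j =>
    listWeight_le h2 hr (by simpa using card_le_univ (L i j))
  have hne : ∀ i j, i ≠ j → W i j ≠ 0 → (L i j).Nonempty := by
    intro i j hij h
    by_contra h'
    rw [not_nonempty_iff_eq_empty] at h'
    exact h (by simp [hW, h'])
  have := toBilin'_self_le (W := W) (M := log r) (by linarith)
    (fun i j => by simp only [hW, eq_comm (a := i), hsymm i j]) (fun i => by simp [hW]) ?_
    (fun _ => 1) (fun _ => zero_le_one)
  · simpa [Matrix.toBilin'_apply] using this
  intro K hK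
  have hKne : ∀ i ∈ K, ∀ j ∈ K, i ≠ j → (L i j).Nonempty := fun i hi j hj hij =>
    hne i j hij (hK i hi j hj hij)
  have hstar : ∀ j ∈ K, ∑ i ∈ K, W i j = ∑ i ∈ K.erase j, listWeight r #(L i j) := by
    intro j hj
    rw [← add_sum_erase K _ hj]
    simp only [hW, if_true, zero_add]
    exact sum_congr rfl fun i hi => if_neg (ne_of_mem_erase hi)
  rcases Nat.lt_or_ge (#K) 3 with h | h
  · left
    intro j hj
    rw [hstar j hj]
    have h1 : ∑ i ∈ K.erase j, listWeight r #(L i j) ≤ #(K.erase j) * log r := by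
      rw [← nsmul_eq_mul]; exact sum_le_card_nsmul _ _ _ fun i _ => hle i j
    rw [card_erase_of_mem hj] at h1
    have h3 : 1 ≤ #K := card_pos.2 ⟨j, hj⟩
    interval_cases #K <;> norm_num at h1 ⊢ <;> linarith
  rcases h.lt_or_eq with h | h
  · left
    intro j hj
    rw [hstar j hj]
    exact sum_listWeight_star_le hsymm hfree h2 hr hKne h hj
  · right
    obtain ⟨a, b, c, hab, hac, hbc, rfl⟩ := card_eq_three.1 h.symm
    refine ⟨a, b, c, hab, hac, hbc, rfl, ?_⟩
    simp only [hW, hab, hac, hbc, if_false]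
    exact ⟨hle _ _, hle _ _, hle _ _, sum_listWeight_triangle_le hsymm hfree h2 hr hab hac hbc
      (hKne a (by simp) b (by simp) hab) (hKne a (by simp) c (by simp) hac)
      (hKne b (by simp) c (by simp) hbc)⟩

end Lists

/-! ### Averaging over samples, and supersaturation. -/

section Sampling

variable {κ ι V : Type*} [Fintype κ] [Fintype ι] [Fintype V] [DecidableEq κ] [DecidableEq ι]

/-- The coordinates outside the range of e are free, and each contributes a factor `Fintype.card V`.
-/
theorem sum_comp_embedding (e : ι → κ) (he : Function.Injective e) (F : (ι → V) → ℝ) :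
    ∑ φ : κ → V, F (φ ∘ e) =
      (Fintype.card V : ℝ) ^ (Fintype.card κ - Fintype.card ι) * ∑ ψ : ι → V, F ψ := by
  classical
  set p : κ → Prop := fun i => i ∈ Set.range e with hp
  let E : {i // p i} ≃ ι := (Equiv.ofInjective e he).symm
  have hE : ∀ i, E ⟨e i, i, rfl⟩ = i := fun i => Equiv.ofInjective_symm_apply he i
  rw [← Equiv.sum_comp (Equiv.piEquivPiSubtypeProd p (fun _ => V)).symm, Fintype.sum_prod_type]
  have h1 : ∀ (f : {i // p i} → V) (g : {i // ¬ p i} → V),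
      F ((Equiv.piEquivPiSubtypeProd p (fun _ => V)).symm (f, g) ∘ e) =
        F (Equiv.arrowCongr E (Equiv.refl V) f) := by
    intro f g
    congr 1
    ext i
    have hi : p (e i) := ⟨i, rfl⟩
    simp only [Function.comp_apply, Equiv.piEquivPiSubtypeProd_symm_apply, hi, dif_pos,
      Equiv.arrowCongr_apply, Equiv.coe_refl, id]
    congr 1
  simp_rw [h1]
  rw [← Equiv.sum_comp (Equiv.arrowCongr E (Equiv.refl V)) F, mul_sum]
  refine sum_congr rfl fun f _ => ?_
  have hc : Fintype.card {i // ¬ p i} = Fintype.card κ - Fintype.card ι := by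
    rw [Fintype.card_subtype_compl, Fintype.card_congr E]
  rw [sum_const, card_univ, Fintype.card_fun, hc, nsmul_eq_mul, Nat.cast_pow]

theorem sum_sample_two {i j : κ} (hij : i ≠ j) (F : V → V → ℝ) :
    ∑ φ : κ → V, F (φ i) (φ j) =
      (Fintype.card V : ℝ) ^ (Fintype.card κ - 2) * ∑ x, ∑ y, F x y := by
  have he : Function.Injective ![i, j] := by
    intro a b; fin_cases a <;> fin_cases b <;> simp [hij, hij.symm]
  have := sum_comp_embedding ![i, j] he (fun ψ : Fin 2 → V => F (ψ 0) (ψ 1))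
  simp only [Function.comp_apply, Matrix.cons_val_zero, Matrix.cons_val_one, Fintype.card_fin]
    at this
  rw [this, ← Equiv.sum_comp (finTwoArrowEquiv V).symm, Fintype.sum_prod_type]
  simp

theorem sum_sample_three {i j k : κ} (hij : i ≠ j) (hjk : j ≠ k) (hik : i ≠ k)
    (F : V → V → V → ℝ) :
    ∑ φ : κ → V, F (φ i) (φ j) (φ k) =
      (Fintype.card V : ℝ) ^ (Fintype.card κ - 3) * ∑ x, ∑ y, ∑ z, F x y z := by
  have he : Function.Injective ![i, j, k] := by
    intro a b
    fin_cases a <;> fin_cases b <;> simp [hij, hij.symm, hjk, hjk.symm, hik, hik.symm]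
  have := sum_comp_embedding ![i, j, k] he (fun ψ : Fin 3 → V => F (ψ 0) (ψ 1) (ψ 2))
  simp only [Function.comp_apply, Matrix.cons_val_zero, Matrix.cons_val_one, Matrix.cons_val,
    Fintype.card_fin] at this
  let E : V × V × V ≃ (Fin 3 → V) :=
    { toFun := fun p => ![p.1, p.2.1, p.2.2]
      invFun := fun ψ => (ψ 0, ψ 1, ψ 2)
      left_inv := fun p => rfl
      right_inv := fun ψ => by ext i; fin_cases i <;> rfl }
  rw [this, ← Equiv.sum_comp E, Fintype.sum_prod_type]
  simp_rw [Fintype.sum_prod_type]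
  rfl

end Sampling

open Classical in
/-- Supersaturation: the weighted Turán bound holds approximately if few triples violate
pattern-freeness. -/
theorem sum_listWeight_le_of_few_bad {V : Type*} [Fintype V] {r : ℕ} (h2 : 2 ≤ r) (hr : r ≤ 26)
    {L : V → V → Finset (Fin r)} (hsymm : ∀ x y, L x y = L y x) {q : ℕ} (hq : 3 ≤ q) {β : ℝ}
    (hbad : ∑ x, ∑ y, ∑ z, (if IsPatternFreeAt L x y z then 0 else 1 : ℝ) ≤
      β * (Fintype.card V : ℝ) ^ 3) :
    (q * (q - 1) : ℝ) * ∑ x, ∑ y, listWeight r #(L x y) ≤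
      (q ^ 2 * log r / 2 + q ^ 5 * log r * β) * (Fintype.card V : ℝ) ^ 2 := by
  set n := Fintype.card V with hn
  rcases Nat.eq_zero_or_pos n with h0 | hpos
  · have : IsEmpty V := Fintype.card_eq_zero_iff.1 (hn ▸ h0)
    simp [h0]
  have hn' : (0 : ℝ) < n := by exact_mod_cast hpos
  have hlr := log_natCast_ge h2
  set w : V → V → ℝ := fun x y => listWeight r #(L x y) with hw
  have hwle : ∀ x y, w x y ≤ log r := fun x y =>
    listWeight_le h2 hr (by simpa using card_le_univ (L x y))
  set b : V → V → V → ℝ := fun x y z => if IsPatternFreeAt L x y z then 0 else 1 with hb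
  have hb0 : ∀ x y z, 0 ≤ b x y z := fun x y z => by
    simp only [hb]; split_ifs <;> norm_num
  let D : Finset (Fin q × Fin q × Fin q) := {t | t.1 ≠ t.2.1 ∧ t.2.1 ≠ t.2.2 ∧ t.1 ≠ t.2.2}
  let D2 : Finset (Fin q × Fin q) := {t | t.1 ≠ t.2}
  have hD : (#D : ℝ) ≤ (q : ℝ) ^ 3 := by
    have : #D ≤ q ^ 3 := (card_le_univ D).trans (by simp; ring_nf; rfl)
    exact_mod_cast this
  have hD2 : (#D2 : ℝ) = q * (q - 1) := by
    have h := offDiag_card (univ : Finset (Fin q))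
    have e : (univ : Finset (Fin q)).offDiag = D2 := by ext t; simp [D2]
    rw [e, card_univ, Fintype.card_fin] at h
    rw [h, Nat.cast_sub (Nat.le_mul_self q)]; push_cast; ring
  -- A sample without bad triples obeys the Turán bound; any other sample obeys the trivial bound q²
  -- log r, charged to one of its bad triples. Averaging over at most q³ triples of indices yields
  -- the factor q⁵. Samples may repeat vertices, since the lists are compared at distinct indices
  -- only.
  have main : ∀ φ : Fin q → V, ∑ t ∈ D2, w (φ t.1) (φ t.2) ≤
      q ^ 2 * log r / 2 + q ^ 2 * log r * ∑ t ∈ D, b (φ t.1) (φ t.2.1) (φ t.2.2) := by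
    intro φ
    have hDn : 0 ≤ ∑ t ∈ D, b (φ t.1) (φ t.2.1) (φ t.2.2) := sum_nonneg fun _ _ => hb0 _ _ _
    by_cases h : ∀ i j k, i ≠ j → j ≠ k → i ≠ k → IsPatternFreeAt L (φ i) (φ j) (φ k)
    · have := sum_listWeight_le (κ := Fin q) (L := fun i j => L (φ i) (φ j))
        (fun i j => hsymm _ _) h h2 hr
      have e : ∑ t ∈ D2, w (φ t.1) (φ t.2) =
          ∑ i, ∑ j, (if i = j then 0 else listWeight r #(L (φ i) (φ j))) := by
        rw [← Fintype.sum_prod_type', sum_filter]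
        refine sum_congr rfl fun t _ => ?_
        by_cases ht : t.1 = t.2 <;> simp [ht, hw]
      rw [e]
      rw [Fintype.card_fin] at this
      nlinarith [mul_nonneg (by positivity : (0 : ℝ) ≤ q ^ 2 * log r) hDn]
    · push Not at h
      obtain ⟨i, j, k, hij, hjk, hik, hbad⟩ := h
      have h1 : 1 ≤ ∑ t ∈ D, b (φ t.1) (φ t.2.1) (φ t.2.2) := by
        have := single_le_sum (f := fun t : Fin q × Fin q × Fin q => b (φ t.1) (φ t.2.1) (φ t.2.2))
          (fun _ _ => hb0 _ _ _) (show (i, j, k) ∈ D by simp [D, hij, hjk, hik])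
        simpa [hb, hbad] using this
      have h2' : ∑ t ∈ D2, w (φ t.1) (φ t.2) ≤ #D2 * log r := by
        rw [← nsmul_eq_mul]; exact sum_le_card_nsmul _ _ _ fun t _ => hwle _ _
      rw [hD2] at h2'
      have h3 : (q : ℝ) * (q - 1) * log r ≤ q ^ 2 * log r := by
        apply mul_le_mul_of_nonneg_right _ (by linarith)
        nlinarith [(Nat.cast_nonneg q : (0 : ℝ) ≤ q)]
      have h4 := mul_le_mul_of_nonneg_left h1 (by positivity : (0 : ℝ) ≤ q ^ 2 * log r)
      have h5 : (0 : ℝ) ≤ q ^ 2 * log r / 2 := by positivity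
      linarith
  have hsum := sum_le_sum fun φ (_ : φ ∈ (univ : Finset (Fin q → V))) => main φ
  rw [sum_comm, sum_add_distrib, ← mul_sum, sum_comm (t := D)] at hsum
  have e1 : ∑ t ∈ D2, ∑ φ : Fin q → V, w (φ t.1) (φ t.2) =
      #D2 * ((n : ℝ) ^ (q - 2) * ∑ x, ∑ y, w x y) := by
    rw [← nsmul_eq_mul, ← sum_const]
    refine sum_congr rfl fun t ht => ?_
    rw [sum_sample_two (mem_filter.1 ht).2 w, Fintype.card_fin]
  have e2 : ∑ t ∈ D, ∑ φ : Fin q → V, b (φ t.1) (φ t.2.1) (φ t.2.2) =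
      #D * ((n : ℝ) ^ (q - 3) * ∑ x, ∑ y, ∑ z, b x y z) := by
    rw [← nsmul_eq_mul, ← sum_const]
    refine sum_congr rfl fun t ht => ?_
    obtain ⟨h1, h2, h3⟩ := (mem_filter.1 ht).2
    rw [sum_sample_three h1 h2 h3 b, Fintype.card_fin]
  rw [e1, e2, hD2, sum_const, card_univ, Fintype.card_fun, Fintype.card_fin, nsmul_eq_mul,
    Nat.cast_pow, ← hn] at hsum
  have p2 : (n : ℝ) ^ q = n ^ (q - 2) * n ^ 2 := by rw [← pow_add]; congr 1; omega
  have p3 : (n : ℝ) ^ (q - 2) * n ^ 2 = n ^ (q - 3) * n ^ 3 := by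
    rw [← pow_add, ← pow_add]; congr 1; omega
  have h3 : (#D : ℝ) * ((n : ℝ) ^ (q - 3) * ∑ x, ∑ y, ∑ z, b x y z) ≤
      q ^ 3 * (n ^ (q - 2) * n ^ 2 * β) := by
    rw [p3, mul_assoc ((n : ℝ) ^ (q - 3)), mul_comm _ β]
    have hB : 0 ≤ ∑ x, ∑ y, ∑ z, b x y z :=
      sum_nonneg fun _ _ => sum_nonneg fun _ _ => sum_nonneg fun _ _ => hb0 _ _ _
    gcongr
  have h4 := mul_le_mul_of_nonneg_left h3 (by positivity : (0 : ℝ) ≤ q ^ 2 * log r)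
  rw [p2] at hsum
  have hpq : (0 : ℝ) < n ^ (q - 2) := by positivity
  refine le_of_mul_le_mul_left ?_ hpq
  calc (n : ℝ) ^ (q - 2) * ((q * (q - 1) : ℝ) * ∑ x, ∑ y, w x y)
      = q * (q - 1) * (n ^ (q - 2) * ∑ x, ∑ y, w x y) := by ring
    _ ≤ _ := hsum
    _ ≤ n ^ (q - 2) * n ^ 2 * (q ^ 2 * log r / 2) +
        q ^ 2 * log r * (q ^ 3 * (n ^ (q - 2) * n ^ 2 * β)) := by linarith
    _ = _ := by ring

/-! ### Block averages and the energy increment. -/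

section BlockAverage

/-- The function obtained from `f` by averaging over the fibers of `p`. -/
noncomputable def blockAvg {X κ : Type*} [Fintype X] [DecidableEq κ] (p : X → κ) (f : X → ℝ) (x : X) : ℝ :=
  (∑ y with p y = p x, f y) / #{y | p y = p x}

variable {X κ κ' : Type*} [Fintype X] [DecidableEq κ] [DecidableEq κ'] {p : X → κ} {p' : X → κ'} {f : X → ℝ}

theorem blockAvg_congr {x y : X} (h : p x = p y) : blockAvg p f x = blockAvg p f y := by
  unfold blockAvg; rw [h]

theorem card_fiber_pos (x : X) : (0 : ℝ) < #{y | p y = p x} := by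
  exact_mod_cast card_pos.2 ⟨x, by simp⟩

theorem blockAvg_nonneg (hf : ∀ x, 0 ≤ f x) (x : X) : 0 ≤ blockAvg p f x :=
  div_nonneg (sum_nonneg fun y _ => hf y) (Nat.cast_nonneg _)

theorem blockAvg_le_one (hf : ∀ x, f x ≤ 1) (x : X) : blockAvg p f x ≤ 1 := by
  unfold blockAvg
  rw [div_le_one (card_fiber_pos x)]
  have := sum_le_card_nsmul ({y | p y = p x} : Finset X) f 1 fun y _ => hf y
  rwa [nsmul_eq_mul, mul_one] at this

/-- Averaging over blocks is the orthogonal projection onto functions constant on blocks. -/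
theorem sum_blockAvg_mul {g : X → ℝ} (hg : ∀ x y, p x = p y → g x = g y) :
    ∑ x, blockAvg p f x * g x = ∑ x, f x * g x := by
  have h1 : ∀ x, blockAvg p f x * g x =
      ∑ y, if p y = p x then f y * g y / #{z | p z = p y} else 0 := by
    intro x
    rw [blockAvg, ← sum_filter, div_mul_eq_mul_div, sum_mul, sum_div]
    refine sum_congr rfl fun y hy => ?_
    simp only [mem_filter, mem_univ, true_and] at hy
    simp only [hy, hg y x hy]
  simp_rw [h1]
  rw [sum_comm]
  refine sum_congr rfl fun y _ => ?_
  rw [← sum_filter, sum_const, nsmul_eq_mul]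
  have : #{x | p y = p x} = #{z | p z = p y} := by simp only [eq_comm]
  rw [this, mul_div_cancel₀ _ (card_fiber_pos y).ne']

/-- Pythagoras for two nested projections. -/
theorem sum_sq_blockAvg_sub (h : ∀ x y, p' x = p' y → p x = p y) :
    ∑ x, (blockAvg p f x - blockAvg p' f x) ^ 2 =
      ∑ x, blockAvg p' f x ^ 2 - ∑ x, blockAvg p f x ^ 2 := by
  have e1 : ∑ x, blockAvg p' f x * blockAvg p f x = ∑ x, f x * blockAvg p f x :=
    sum_blockAvg_mul fun x y hxy => blockAvg_congr (h x y hxy)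
  have e2 : ∑ x, blockAvg p f x * blockAvg p f x = ∑ x, f x * blockAvg p f x :=
    sum_blockAvg_mul fun x y hxy => blockAvg_congr hxy
  have e3 : ∀ x, (blockAvg p f x - blockAvg p' f x) ^ 2 = blockAvg p' f x ^ 2 -
      blockAvg p f x ^ 2 + 2 * (blockAvg p f x * blockAvg p f x) -
      2 * (blockAvg p' f x * blockAvg p f x) := fun x => by ring
  simp_rw [e3]
  rw [sum_sub_distrib, sum_add_distrib, sum_sub_distrib, ← mul_sum, ← mul_sum, e1, e2]
  ring

theorem energy_mono (h : ∀ x y, p' x = p' y → p x = p y) :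
    ∑ x, blockAvg p f x ^ 2 ≤ ∑ x, blockAvg p' f x ^ 2 := by
  have := sum_sq_blockAvg_sub (f := f) h
  have : 0 ≤ ∑ x, (blockAvg p f x - blockAvg p' f x) ^ 2 := sum_nonneg fun _ _ => sq_nonneg _
  linarith

/-- Refining a partition so that it sees a large deviation of `f` from its average increases the
energy. -/
theorem energy_increment (h : ∀ x y, p' x = p' y → p x = p y) {g : X → ℝ}
    (hg : ∀ x y, p' x = p' y → g x = g y) (hg1 : ∀ x, g x ^ 2 ≤ 1) {ε : ℝ} (hε : 0 ≤ ε)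
    (hdev : ε * Fintype.card X < ∑ x, (blockAvg p f x - f x) * g x) :
    ∑ x, blockAvg p f x ^ 2 + ε ^ 2 * Fintype.card X ≤ ∑ x, blockAvg p' f x ^ 2 := by
  have e : ∑ x, (blockAvg p f x - f x) * g x =
      ∑ x, (blockAvg p f x - blockAvg p' f x) * g x := by
    simp_rw [sub_mul]
    rw [sum_sub_distrib, sum_sub_distrib, sum_blockAvg_mul hg]
  rw [e] at hdev
  have cs := sum_mul_sq_le_sq_mul_sq univ (fun x => blockAvg p f x - blockAvg p' f x) g
  rw [sum_sq_blockAvg_sub h] at cs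
  have hE := energy_mono (f := f) h
  have hG : ∑ x, g x ^ 2 ≤ Fintype.card X := by
    simpa using sum_le_card_nsmul univ (fun x => g x ^ 2) 1 fun x _ => hg1 x
  rcases Nat.eq_zero_or_pos (Fintype.card X) with h0 | hpos
  · simp only [h0, Nat.cast_zero, mul_zero, add_zero]; exact hE
  have hX : (0 : ℝ) < Fintype.card X := by exact_mod_cast hpos
  have h1 : (ε * Fintype.card X) ^ 2 ≤
      (∑ x, (blockAvg p f x - blockAvg p' f x) * g x) ^ 2 :=
    pow_le_pow_left₀ (by positivity) hdev.le 2
  have h2 := mul_le_mul_of_nonneg_left hG (sub_nonneg.2 hE)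
  have h3 : (ε ^ 2 * Fintype.card X) * Fintype.card X ≤
      (∑ x, blockAvg p' f x ^ 2 - ∑ x, blockAvg p f x ^ 2) * Fintype.card X := by nlinarith
  have := le_of_mul_le_mul_right h3 hX
  linarith

end BlockAverage

/-! ### Weak regularity and triangle counting. -/

section CutNorm

variable {V : Type*} [Fintype V]

open Classical in
theorem exists_finset_sum_mul_le (h u : V → ℝ) (hu : ∀ x, u x ∈ Set.Icc (0 : ℝ) 1) :
    ∃ S : Finset V, ∑ x, h x * u x ≤ ∑ x, h x * (if x ∈ S then 1 else 0) := by
  refine ⟨({x | 0 ≤ h x} : Finset V), sum_le_sum fun x _ => ?_⟩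
  by_cases hx : 0 ≤ h x
  · simp only [mem_filter, mem_univ, true_and, hx, if_true]
    exact mul_le_mul_of_nonneg_left (hu x).2 hx
  · simp only [mem_filter, mem_univ, true_and, hx, if_false]
    nlinarith [(hu x).1]

open Classical in
/-- A bilinear form on functions with values in `[0, 1]` is at most one of its values at
indicators. -/
theorem exists_finset_sum_mul_mul_le (g : V × V → ℝ) (u v : V → ℝ)
    (hu : ∀ x, u x ∈ Set.Icc (0 : ℝ) 1) (hv : ∀ x, v x ∈ Set.Icc (0 : ℝ) 1) :
    ∃ S T : Finset V, ∑ x, ∑ y, g (x, y) * (u x * v y) ≤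
      ∑ x, ∑ y, g (x, y) * ((if x ∈ S then 1 else 0) * (if y ∈ T then 1 else 0)) := by
  obtain ⟨S, hS⟩ := exists_finset_sum_mul_le (fun x => ∑ y, g (x, y) * v y) u hu
  obtain ⟨T, hT⟩ := exists_finset_sum_mul_le
    (fun y => ∑ x, g (x, y) * (if x ∈ S then 1 else 0)) v hv
  refine ⟨S, T, ?_⟩
  calc ∑ x, ∑ y, g (x, y) * (u x * v y) = ∑ x, (∑ y, g (x, y) * v y) * u x := by
        refine sum_congr rfl fun x _ => ?_
        rw [sum_mul]; exact sum_congr rfl fun y _ => by ring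
    _ ≤ ∑ x, (∑ y, g (x, y) * v y) * (if x ∈ S then 1 else 0) := hS
    _ = ∑ y, (∑ x, g (x, y) * (if x ∈ S then 1 else 0)) * v y := by
        simp_rw [sum_mul]
        rw [sum_comm]
        exact sum_congr rfl fun y _ => sum_congr rfl fun x _ => by ring
    _ ≤ ∑ y, (∑ x, g (x, y) * (if x ∈ S then 1 else 0)) * (if y ∈ T then 1 else 0) := hT
    _ = _ := by
        simp_rw [sum_mul]
        rw [sum_comm]
        exact sum_congr rfl fun y _ => sum_congr rfl fun x _ => by ring

/-- `f'` exceeds `f` by at most `ε |V|²` on each rectangle. -/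
def CutLE (ε : ℝ) (f f' : V × V → ℝ) : Prop :=
  ∀ u v : V → ℝ, (∀ x, u x ∈ Set.Icc (0 : ℝ) 1) → (∀ x, v x ∈ Set.Icc (0 : ℝ) 1) →
    ∑ x, ∑ y, (f' (x, y) - f (x, y)) * (u x * v y) ≤ ε * (Fintype.card V : ℝ) ^ 2

/-- N bounds the number of refinements still possible: each failure of regularity raises the total
energy by ε²|V|² and splits every part into at most four, while the energy never exceeds the number
of functions times |V|². -/
theorem exists_cutLE_blockAvg_of_energy {ι : Type*} [Fintype ι] {ε : ℝ} (hε : 0 < ε)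
    {f : ι → V × V → ℝ} (hf0 : ∀ i x, 0 ≤ f i x) (hf1 : ∀ i x, f i x ≤ 1) (N : ℕ) :
    ∀ (K : ℕ) (P : V → Fin K),
      (Fintype.card ι - N * ε ^ 2) * (Fintype.card V : ℝ) ^ 2 <
        ∑ i, ∑ x, blockAvg (Prod.map P P) (f i) x ^ 2 →
      ∃ P' : V → Fin (K * 4 ^ N), ∀ i, CutLE ε (f i) (blockAvg (Prod.map P' P') (f i)) := by
  classical
  induction N with
  | zero =>
    intro K P h
    exfalso
    have : ∑ i, ∑ x, blockAvg (Prod.map P P) (f i) x ^ 2 ≤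
        ∑ _i : ι, ∑ _x : V × V, (1 : ℝ) :=
      sum_le_sum fun i _ => sum_le_sum fun x _ =>
        pow_le_one₀ (blockAvg_nonneg (hf0 i) x) (blockAvg_le_one (hf1 i) x)
    simp at this h
    nlinarith
  | succ N ih =>
    intro K P h
    by_cases hreg : ∀ i, CutLE ε (f i) (blockAvg (Prod.map P P) (f i))
    · have hle : K ≤ K * 4 ^ (N + 1) := Nat.le_mul_of_pos_right _ (by positivity)
      refine ⟨Fin.castLE hle ∘ P, fun i => ?_⟩
      have : blockAvg (Prod.map (Fin.castLE hle ∘ P) (Fin.castLE hle ∘ P)) (f i) =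
          blockAvg (Prod.map P P) (f i) := by
        ext x
        simp [blockAvg, Prod.ext_iff]
      rw [this]
      exact hreg i
    · push Not at hreg
      obtain ⟨i, hi⟩ := hreg
      unfold CutLE at hi
      push Not at hi
      obtain ⟨u, v, hu, hv, hdev⟩ := hi
      obtain ⟨S, T, hST⟩ := exists_finset_sum_mul_mul_le
        (fun x => blockAvg (Prod.map P P) (f i) x - f i x) u v hu hv
      -- The refinement records membership in S and T, so that the violating rectangle is a union of
      -- blocks.
      let code : V → Fin 4 := fun x =>
        finProdFinEquiv ((if x ∈ S then 1 else 0 : Fin 2), (if x ∈ T then 1 else 0 : Fin 2))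
      let P₁ : V → Fin (K * 4) := fun x => finProdFinEquiv (P x, code x)
      have hP : ∀ x y, P₁ x = P₁ y → P x = P y ∧ (x ∈ S ↔ y ∈ S) ∧ (x ∈ T ↔ y ∈ T) := by
        intro x y hxy
        have h1 := finProdFinEquiv.injective hxy
        rw [Prod.mk.injEq] at h1
        have h2 := finProdFinEquiv.injective h1.2
        rw [Prod.mk.injEq] at h2
        refine ⟨h1.1, ?_, ?_⟩
        · have := h2.1; split_ifs at this <;> simp_all
        · have := h2.2; split_ifs at this <;> simp_all
      have href : ∀ x y : V × V, Prod.map P₁ P₁ x = Prod.map P₁ P₁ y →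
          Prod.map P P x = Prod.map P P y := by
        intro x y hxy
        simp only [Prod.ext_iff, Prod.map_fst, Prod.map_snd] at hxy ⊢
        exact ⟨(hP _ _ hxy.1).1, (hP _ _ hxy.2).1⟩
      have hinc := energy_increment (f := f i) href
        (g := fun x => (if x.1 ∈ S then 1 else 0) * (if x.2 ∈ T then 1 else 0))
        (by
          intro x y hxy
          simp only [Prod.ext_iff, Prod.map_fst, Prod.map_snd] at hxy
          simp only [(hP _ _ hxy.1).2.1, (hP _ _ hxy.2).2.2])
        (by intro x; split_ifs <;> norm_num) hε.le
        (by
          rw [Fintype.card_prod, Fintype.sum_prod_type]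
          push_cast
          refine lt_of_lt_of_le ?_ hST
          rw [← sq]
          exact hdev)
      have htot : ∑ j, ∑ x, blockAvg (Prod.map P P) (f j) x ^ 2 + ε ^ 2 * Fintype.card (V × V) ≤
          ∑ j, ∑ x, blockAvg (Prod.map P₁ P₁) (f j) x ^ 2 := by
        rw [← add_sum_erase _ _ (mem_univ i),
          ← add_sum_erase _ (fun j => ∑ x, blockAvg (Prod.map P₁ P₁) (f j) x ^ 2) (mem_univ i)]
        have := sum_le_sum fun j (_ : j ∈ univ.erase i) => energy_mono (f := f j) href
        linarith
      obtain ⟨P', hP'⟩ := ih (K * 4) P₁ (by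
        rw [Fintype.card_prod] at htot
        push_cast at htot h
        nlinarith)
      have hK : K * 4 * 4 ^ N = K * 4 ^ (N + 1) := by ring
      exact hK ▸ ⟨P', hP'⟩

end CutNorm

/-- A one-sided form of the weak regularity lemma of Frieze and Kannan, for several functions at
once. -/
theorem exists_cutLE_blockAvg (m : ℕ) {ε : ℝ} (hε : 0 < ε) :
    ∃ K : ℕ, ∀ (V : Type*) [Fintype V] [Nonempty V] (f : Fin m → V × V → ℝ),
      (∀ i x, 0 ≤ f i x) → (∀ i x, f i x ≤ 1) →
      ∃ P : V → Fin K, ∀ i, CutLE ε (f i) (blockAvg (Prod.map P P) (f i)) := by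
  obtain ⟨N, hN⟩ := exists_nat_gt (m / ε ^ 2)
  refine ⟨1 * 4 ^ N, fun V _ _ f hf0 hf1 => ?_⟩
  refine exists_cutLE_blockAvg_of_energy hε hf0 hf1 N 1 (fun _ => 0) ?_
  rw [div_lt_iff₀ (by positivity)] at hN
  have hV : (0 : ℝ) < Fintype.card V := by exact_mod_cast Fintype.card_pos
  have h1 : ((Fintype.card (Fin m) : ℝ) - N * ε ^ 2) * (Fintype.card V : ℝ) ^ 2 < 0 := by
    rw [Fintype.card_fin]
    exact mul_neg_of_neg_of_pos (by linarith) (by positivity)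
  exact h1.trans_le (sum_nonneg fun _ _ => sum_nonneg fun _ _ => sq_nonneg _)

/-- One-sided triangle counting for the cut norm. -/
theorem sum_triangle_le {V : Type*} [Fintype V] {ε : ℝ} {f g h f' g' h' : V × V → ℝ}
    (hf : ∀ x, f x ∈ Set.Icc (0 : ℝ) 1) (hg : ∀ x, g x ∈ Set.Icc (0 : ℝ) 1)
    (hg' : ∀ x, g' x ∈ Set.Icc (0 : ℝ) 1)
    (hh' : ∀ x, h' x ∈ Set.Icc (0 : ℝ) 1)
    (cf : CutLE ε f f') (cg : CutLE ε g g') (ch : CutLE ε h h') :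
    ∑ x, ∑ y, ∑ z, f' (x, y) * g' (y, z) * h' (x, z) ≤
      ∑ x, ∑ y, ∑ z, f (x, y) * g (y, z) * h (x, z) + 3 * ε * (Fintype.card V : ℝ) ^ 3 := by
  have const : ∀ F : V → ℝ, (∀ x, F x ≤ ε * (Fintype.card V : ℝ) ^ 2) →
      ∑ x, F x ≤ ε * (Fintype.card V : ℝ) ^ 3 := by
    intro F hF
    have := sum_le_card_nsmul univ F _ fun x _ => hF x
    rw [card_univ, nsmul_eq_mul] at this
    linarith
  have h1 : ∑ x, ∑ y, ∑ z, (f' (x, y) - f (x, y)) * g' (y, z) * h' (x, z) ≤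
      ε * (Fintype.card V : ℝ) ^ 3 := by
    calc _ = ∑ z, ∑ x, ∑ y, (f' (x, y) - f (x, y)) * (h' (x, z) * g' (y, z)) := by
          rw [sum_comm]
          conv_rhs => rw [sum_comm]
          conv_rhs => enter [2, x]; rw [sum_comm]
          rw [sum_comm]
          exact sum_congr rfl fun x _ => sum_congr rfl fun y _ => sum_congr rfl fun z _ => by ring
      _ ≤ _ := const _ fun z => cf _ _ (fun x => hh' (x, z)) (fun y => hg' (y, z))
  have h2 : ∑ x, ∑ y, ∑ z, f (x, y) * (g' (y, z) - g (y, z)) * h' (x, z) ≤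
      ε * (Fintype.card V : ℝ) ^ 3 := by
    calc _ = ∑ x, ∑ y, ∑ z, (g' (y, z) - g (y, z)) * (f (x, y) * h' (x, z)) :=
          sum_congr rfl fun x _ => sum_congr rfl fun y _ => sum_congr rfl fun z _ => by ring
      _ ≤ _ := const _ fun x => cg _ _ (fun y => hf (x, y)) (fun z => hh' (x, z))
  have h3 : ∑ x, ∑ y, ∑ z, f (x, y) * g (y, z) * (h' (x, z) - h (x, z)) ≤
      ε * (Fintype.card V : ℝ) ^ 3 := by
    calc _ = ∑ y, ∑ x, ∑ z, (h' (x, z) - h (x, z)) * (f (x, y) * g (y, z)) := by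
          rw [sum_comm]
          exact sum_congr rfl fun x _ => sum_congr rfl fun y _ => sum_congr rfl fun z _ => by ring
      _ ≤ _ := const _ fun y => ch _ _ (fun x => hf (x, y)) (fun z => hg (y, z))
  -- Telescoping: the three factors are replaced one at a time. In each difference, fixing the
  -- vertex opposite to the changing edge leaves a cut-norm test.
  have e : ∑ x, ∑ y, ∑ z, f' (x, y) * g' (y, z) * h' (x, z) =
      ∑ x, ∑ y, ∑ z, f (x, y) * g (y, z) * h (x, z) +
      ∑ x, ∑ y, ∑ z, (f' (x, y) - f (x, y)) * g' (y, z) * h' (x, z) +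
      ∑ x, ∑ y, ∑ z, f (x, y) * (g' (y, z) - g (y, z)) * h' (x, z) +
      ∑ x, ∑ y, ∑ z, f (x, y) * g (y, z) * (h' (x, z) - h (x, z)) := by
    simp_rw [← sum_add_distrib]
    exact sum_congr rfl fun x _ => sum_congr rfl fun y _ => sum_congr rfl fun z _ => by ring
  linarith

/-! ### Templates of pattern-free colorings. -/

section Template

variable {V : Type*} {G : SimpleGraph V} {r : ℕ}

/-- In a pattern-free coloring, two edges of a triangle of the same color force the color of the
third one. -/
theorem IsPatternFree.eq_of_triangle {c : G.EdgeLabeling (Fin r)}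
    (hc : IsPatternFree triangleTwo c) {x y z : V} (hxy : G.Adj x y) (hyz : G.Adj y z)
    (hxz : G.Adj x z) (h : c.get x y hxy = c.get y z hyz) : c.get x y hxy = c.get x z hxz := by
  by_contra hne
  -- The singled-out edge `{0, 1}` of the pattern goes to xz.
  let f : Fin 3 → V := ![x, z, y]
  have hinj : Function.Injective f := by
    intro i j
    fin_cases i <;> fin_cases j <;>
      simp [f, hxy.ne, hxy.ne', hyz.ne, hyz.ne', hxz.ne, hxz.ne']
  have hadj : ∀ {i j : Fin 3}, triangle.Adj i j → G.Adj (f i) (f j) := by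
    intro i j
    fin_cases i <;> fin_cases j <;>
      simp [f, hxy, hxy.symm, hyz, hyz.symm, hxz, hxz.symm]
  let F : SimpleGraph.Copy triangle G := ⟨⟨f, hadj⟩, hinj⟩
  refine hc F ?_
  have val' : ∀ i j (hij : triangle.Adj i j), c.get (f i) (f j) (hadj hij) =
      if s(i, j) = s(0, 1) then c.get x z hxz else c.get x y hxy := by
    intro i j hij
    fin_cases i <;> fin_cases j
    · exact absurd rfl hij.ne
    · exact (if_pos rfl).symm
    · exact (if_neg (by decide)).symm
    · exact (c.get_comm x z _).trans (if_pos (by decide)).symm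
    · exact absurd rfl hij.ne
    · exact ((c.get_comm y z _).trans h.symm).trans (if_neg (by decide)).symm
    · exact (c.get_comm x y _).trans (if_neg (by decide)).symm
    · exact h.symm.trans (if_neg (by decide)).symm
    · exact absurd rfl hij.ne
  have val : ∀ e : triangle.edgeSet,
      c (F.mapEdgeSet e) = if (e : Sym2 (Fin 3)) = s(0, 1) then c.get x z hxz else c.get x y hxy := by
    rintro ⟨e, he⟩
    induction e with
    | _ i j => exact val' i j he
  ext e e'
  simp only [Setoid.ker_def, val]
  by_cases h1 : (e : Sym2 (Fin 3)) = s(0, 1) <;> by_cases h2 : (e' : Sym2 (Fin 3)) = s(0, 1)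
  · simp [h1, h2]
  · simp [h1, h2, Ne.symm hne, eq_comm]
  · simp [h1, h2, hne]
  · simp only [h1, h2]

open Classical in
/-- The indicator function of the color class `i`. -/
noncomputable def colorInd (c : G.EdgeLabeling (Fin r)) (i : Fin r) (p : V × V) : ℝ :=
  if ∃ h : G.Adj p.1 p.2, c.get p.1 p.2 h = i then 1 else 0

theorem colorInd_mem (c : G.EdgeLabeling (Fin r)) (i : Fin r) (p : V × V) :
    colorInd c i p ∈ Set.Icc (0 : ℝ) 1 := by
  unfold colorInd; split_ifs <;> simp

theorem colorInd_swap (c : G.EdgeLabeling (Fin r)) (i : Fin r) (x y : V) :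
    colorInd c i (x, y) = colorInd c i (y, x) := by
  unfold colorInd
  congr 1
  simp only [eq_iff_iff]
  exact ⟨fun ⟨h, e⟩ => ⟨h.symm, by rw [← e]; exact c.get_comm x y _⟩,
    fun ⟨h, e⟩ => ⟨h.symm, by rw [← e]; exact c.get_comm y x _⟩⟩

theorem colorInd_triangle {c : G.EdgeLabeling (Fin r)} (hc : IsPatternFree triangleTwo c)
    {a b : Fin r} (hab : a ≠ b) (x y z : V) :
    colorInd c a (x, y) * colorInd c a (y, z) * colorInd c b (x, z) = 0 := by
  unfold colorInd
  split_ifs with h1 h2 h3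
  · obtain ⟨hxy, h1⟩ := h1
    obtain ⟨hyz, h2⟩ := h2
    obtain ⟨hxz, h3⟩ := h3
    exact absurd (h1.symm.trans ((hc.eq_of_triangle hxy hyz hxz (h1.trans h2.symm)).trans h3)) hab
  all_goals simp

theorem blockAvg_swap [Fintype V] {κ : Type*} [DecidableEq κ] (P : V → κ) {f : V × V → ℝ}
    (hf : ∀ x y, f (x, y) = f (y, x)) (x y : V) :
    blockAvg (Prod.map P P) f (x, y) = blockAvg (Prod.map P P) f (y, x) := by
  unfold blockAvg
  congr 1
  · rw [sum_filter, sum_filter, ← Equiv.sum_comp (Equiv.prodComm V V)]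
    refine sum_congr rfl fun p _ => ?_
    simp only [Equiv.prodComm_apply, Prod.ext_iff, Prod.map_fst, Prod.map_snd, Prod.fst_swap,
      Prod.snd_swap, and_comm]
    rw [show f p.swap = f p from hf _ _]
  · congr 1
    refine card_equiv (Equiv.prodComm V V) fun p => ?_
    simp [Prod.ext_iff, and_comm]

open Classical in
/-- A choice of lists for the pairs of vertices that approximates the coloring `c`: few triples
violate pattern-freeness, and few edges have a color outside of their list. -/
structure IsTemplate [Fintype V] (c : G.EdgeLabeling (Fin r)) (L : V → V → Finset (Fin r))
    (β θ : ℝ) : Prop where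
  symm : ∀ x y, L x y = L y x
  bad : ∑ x, ∑ y, ∑ z, (if IsPatternFreeAt L x y z then 0 else 1 : ℝ) ≤
    β * (Fintype.card V : ℝ) ^ 3
  exc : (#{p : V × V | ∃ h : G.Adj p.1 p.2, c.get p.1 p.2 h ∉ L p.1 p.2} : ℝ) ≤
    θ * (Fintype.card V : ℝ) ^ 2

end Template

-- Lists consist of the colors of density at least η. A bad triple contributes at least η³ to a
-- triangle count of densities whose original is zero, so the counting lemma makes such triples
-- rare; each discarded color covers at most ηn² ordered pairs. That the lists are determined by P
-- and Λ is what keeps the number of templates small.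
open Classical in
theorem exists_isTemplate (r : ℕ) {β θ : ℝ} (hβ : 0 < β) (hθ : 0 < θ) :
    ∃ K : ℕ, ∀ (V : Type*) [Fintype V] [Nonempty V] (G : SimpleGraph V)
      (c : G.EdgeLabeling (Fin r)), IsPatternFree triangleTwo c →
      ∃ (P : V → Fin K) (Λ : Fin K → Fin K → Finset (Fin r)),
        IsTemplate c (fun x y => Λ (P x) (P y)) β θ := by
  set η : ℝ := θ / (r + 1) with hη
  have hη0 : 0 < η := by positivity
  set ε : ℝ := β * η ^ 3 / (3 * (r ^ 2 + 1)) with hε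
  have hε0 : 0 < ε := by positivity
  obtain ⟨K, hK⟩ := exists_cutLE_blockAvg r hε0
  refine ⟨K, fun V _ _ G c hc => ?_⟩
  obtain ⟨P, hP⟩ := hK V (colorInd c) (fun i p => (colorInd_mem c i p).1)
    (fun i p => (colorInd_mem c i p).2)
  set n : ℝ := (Fintype.card V : ℝ) with hn
  have hn0 : 0 ≤ n := Nat.cast_nonneg _
  set d : Fin r → V × V → ℝ := fun i => blockAvg (Prod.map P P) (colorInd c i) with hd
  have hd01 : ∀ i p, d i p ∈ Set.Icc (0 : ℝ) 1 := fun i p =>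
    ⟨blockAvg_nonneg (fun p => (colorInd_mem c i p).1) p,
      blockAvg_le_one (fun p => (colorInd_mem c i p).2) p⟩
  let Λ : Fin K → Fin K → Finset (Fin r) := fun A B =>
    {i | ∃ x y, P x = A ∧ P y = B ∧ η ≤ d i (x, y)}
  have hmem : ∀ i x y, i ∈ Λ (P x) (P y) ↔ η ≤ d i (x, y) := by
    intro i x y
    simp only [Λ, mem_filter, mem_univ, true_and]
    constructor
    · rintro ⟨x', y', hx, hy, h⟩
      have : d i (x', y') = d i (x, y) := blockAvg_congr (by simp [hx, hy])
      rwa [this] at h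
    · exact fun h => ⟨x, y, rfl, rfl, h⟩
  have hsw : ∀ i x y, d i (x, y) = d i (y, x) := fun i x y =>
    blockAvg_swap P (colorInd_swap c i) x y
  refine ⟨P, Λ, ?_, ?_, ?_⟩
  · intro x y
    ext i
    rw [hmem, hmem, hsw]
  -- For fixed distinct colors a, b there are at most 3ε/η³ · n³ bad triples; summing over at most
  -- r² pairs of colors gives β, by the choice of ε.
  · have hpair : ∀ a b : Fin r, a ≠ b → ∑ x, ∑ y, ∑ z, (if a ∈ Λ (P x) (P y) ∧ a ∈ Λ (P y) (P z) ∧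
        b ∈ Λ (P x) (P z) then 1 else 0 : ℝ) ≤ 3 * ε / η ^ 3 * n ^ 3 := by
      intro a b hab
      have h1 := sum_triangle_le (colorInd_mem c a) (colorInd_mem c a) (hd01 a) (hd01 b)
        (hP a) (hP a) (hP b)
      simp only [colorInd_triangle hc hab, sum_const_zero, zero_add] at h1
      have h2 : η ^ 3 * ∑ x, ∑ y, ∑ z, (if a ∈ Λ (P x) (P y) ∧ a ∈ Λ (P y) (P z) ∧
          b ∈ Λ (P x) (P z) then 1 else 0 : ℝ) ≤
          ∑ x, ∑ y, ∑ z, d a (x, y) * d a (y, z) * d b (x, z) := by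
        simp_rw [mul_sum]
        refine sum_le_sum fun x _ => sum_le_sum fun y _ => sum_le_sum fun z _ => ?_
        split_ifs with h
        · rw [hmem, hmem, hmem] at h
          obtain ⟨k1, k2, k3⟩ := h
          calc η ^ 3 * 1 = η * η * η := by ring
            _ ≤ _ := mul_le_mul (mul_le_mul k1 k2 hη0.le (hd01 _ _).1) k3 hη0.le
              (mul_nonneg (hd01 _ _).1 (hd01 _ _).1)
        · rw [mul_zero]
          exact mul_nonneg (mul_nonneg (hd01 _ _).1 (hd01 _ _).1) (hd01 _ _).1
      rw [div_mul_eq_mul_div, le_div_iff₀ (by positivity)]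
      linarith
    have h3 : ∑ x, ∑ y, ∑ z, (if IsPatternFreeAt (fun x y => Λ (P x) (P y)) x y z then 0
        else 1 : ℝ) ≤ ∑ x, ∑ y, ∑ z, ∑ t : Fin r × Fin r with t.1 ≠ t.2,
          (if t.1 ∈ Λ (P x) (P y) ∧ t.1 ∈ Λ (P y) (P z) ∧ t.2 ∈ Λ (P x) (P z)
            then 1 else 0 : ℝ) := by
      refine sum_le_sum fun x _ => sum_le_sum fun y _ => sum_le_sum fun z _ => ?_
      have hnn : ∀ t : Fin r × Fin r, (0 : ℝ) ≤ (if t.1 ∈ Λ (P x) (P y) ∧ t.1 ∈ Λ (P y) (P z) ∧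
          t.2 ∈ Λ (P x) (P z) then 1 else 0 : ℝ) := fun t => by split_ifs <;> norm_num
      split_ifs with h
      · exact sum_nonneg fun t _ => hnn t
      · unfold IsPatternFreeAt at h
        push Not at h
        obtain ⟨a, b, k1, k2, k3, hab⟩ := h
        refine le_trans ?_ (single_le_sum (fun t _ => hnn t)
          (show (a, b) ∈ ({t : Fin r × Fin r | t.1 ≠ t.2} : Finset _) by simpa using hab))
        rw [if_pos ⟨k1, k2, k3⟩]
    refine h3.trans ?_
    have h4 : ∑ x, ∑ y, ∑ z, ∑ t : Fin r × Fin r with t.1 ≠ t.2,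
          (if t.1 ∈ Λ (P x) (P y) ∧ t.1 ∈ Λ (P y) (P z) ∧ t.2 ∈ Λ (P x) (P z)
            then 1 else 0 : ℝ) = ∑ t : Fin r × Fin r with t.1 ≠ t.2, ∑ x, ∑ y, ∑ z,
          (if t.1 ∈ Λ (P x) (P y) ∧ t.1 ∈ Λ (P y) (P z) ∧ t.2 ∈ Λ (P x) (P z)
            then 1 else 0 : ℝ) := by
      rw [sum_comm]
      conv_rhs => rw [sum_comm]
      conv_rhs => enter [2, x]; rw [sum_comm]
      conv_rhs => enter [2, x, 2, y]; rw [sum_comm]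
      rw [sum_comm]
    rw [h4]
    have h5 := sum_le_card_nsmul ({t : Fin r × Fin r | t.1 ≠ t.2} : Finset _) _ _
      fun t ht => hpair t.1 t.2 (by simpa using ht)
    refine h5.trans ?_
    rw [nsmul_eq_mul, ← mul_assoc]
    refine mul_le_mul_of_nonneg_right ?_ (by positivity)
    have h6 : (#({t : Fin r × Fin r | t.1 ≠ t.2} : Finset _) : ℝ) ≤ r ^ 2 + 1 := by
      have := card_le_univ ({t : Fin r × Fin r | t.1 ≠ t.2} : Finset _)
      rw [Fintype.card_prod, Fintype.card_fin] at this
      have : (#({t : Fin r × Fin r | t.1 ≠ t.2} : Finset _) : ℝ) ≤ r * r := by exact_mod_cast this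
      linarith [sq (r : ℝ)]
    have h7 : (r ^ 2 + 1 : ℝ) * (3 * ε / η ^ 3) = β := by
      rw [hε]; field_simp
    rw [← h7]
    exact mul_le_mul_of_nonneg_right h6 (by positivity)
  · have h1 : ∀ i, ∑ p : V × V, colorInd c i p *
        (if i ∈ Λ (P p.1) (P p.2) then 0 else 1) ≤ η * n ^ 2 := by
      intro i
      rw [← sum_blockAvg_mul (p := Prod.map P P)]
      · have : ∀ p ∈ (univ : Finset (V × V)), blockAvg (Prod.map P P) (colorInd c i) p *
            (if i ∈ Λ (P p.1) (P p.2) then 0 else 1) ≤ η := by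
          intro p _
          split_ifs with h
          · simpa using hη0.le
          · rw [hmem, not_le] at h
            simpa using h.le
        have := sum_le_card_nsmul _ _ _ this
        rw [card_univ, Fintype.card_prod, nsmul_eq_mul] at this
        push_cast at this
        nlinarith
      · intro p p' h
        simp only [Prod.ext_iff, Prod.map_fst, Prod.map_snd] at h
        rw [h.1, h.2]
    have h2 : (#{p : V × V | ∃ h : G.Adj p.1 p.2, c.get p.1 p.2 h ∉ Λ (P p.1) (P p.2)} : ℝ) ≤
        ∑ i, ∑ p : V × V, colorInd c i p * (if i ∈ Λ (P p.1) (P p.2) then 0 else 1) := by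
      rw [sum_comm, card_filter, Nat.cast_sum]
      refine sum_le_sum fun p _ => ?_
      have hnn : ∀ i ∈ (univ : Finset (Fin r)), (0 : ℝ) ≤ colorInd c i p *
          (if i ∈ Λ (P p.1) (P p.2) then 0 else 1) := fun i _ =>
        mul_nonneg (colorInd_mem c i p).1 (by split_ifs <;> norm_num)
      split_ifs with h
      · obtain ⟨h, h'⟩ := h
        refine le_trans ?_ (single_le_sum hnn (mem_univ (c.get p.1 p.2 h)))
        rw [if_neg h', colorInd, if_pos ⟨h, rfl⟩]
        norm_num
      · simpa using sum_nonneg hnn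
    refine h2.trans ?_
    have h3 := sum_le_card_nsmul univ _ _ fun i (_ : i ∈ (univ : Finset (Fin r))) => h1 i
    rw [card_univ, Fintype.card_fin, nsmul_eq_mul, ← mul_assoc] at h3
    refine h3.trans (mul_le_mul_of_nonneg_right ?_ (by positivity))
    have : (r + 1 : ℝ) * η = θ := by rw [hη]; field_simp
    linarith

/-! ### Counting the colorings that follow given lists. -/

section Counting

variable {V : Type*} [Fintype V] {G : SimpleGraph V} {r : ℕ}

open Classical in
theorem two_mul_sum_edgeSet (g : Sym2 V → ℝ) :
    2 * ∑ e : G.edgeSet, g e = ∑ x, ∑ y, if G.Adj x y then g s(x, y) else 0 := by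
  have h1 : ∑ d : G.Dart, g d.edge = 2 * ∑ e : G.edgeSet, g e := by
    rw [← sum_fiberwise_of_maps_to (s := univ) (t := G.edgeFinset) (g := fun d : G.Dart => d.edge)
      (fun d _ => by simp), mul_sum]
    rw [← sum_subtype G.edgeFinset (fun e => SimpleGraph.mem_edgeFinset) fun e => 2 * g e]
    refine sum_congr rfl fun e he => ?_
    rw [sum_congr rfl fun d hd => by rw [(mem_filter.1 hd).2], sum_const,
      G.dart_edge_fiber_card e (SimpleGraph.mem_edgeFinset.1 he), nsmul_eq_mul, Nat.cast_ofNat]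
  rw [← h1, ← Fintype.sum_prod_type' (f := fun x y => if G.Adj x y then g s(x, y) else 0),
    ← sum_filter]
  refine sum_bij (fun d _ => d.toProd) (fun d _ => by simp)
    (fun d _ d' _ h => SimpleGraph.Dart.ext _ _ h) (fun p hp => ?_) (fun d _ => rfl)
  exact ⟨⟨p, (mem_filter.1 hp).2⟩, mem_univ _, rfl⟩

open Classical in
/-- The number of colorings with few edges whose color is outside of its list. -/
theorem log_card_colorings_le {L : V → V → Finset (Fin r)} (hsymm : ∀ x y, L x y = L y x)
    {θ s : ℝ} (hs : 0 ≤ s) (S : Finset (G.EdgeLabeling (Fin r))) (hne : S.Nonempty)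
    (hS : ∀ c ∈ S, (#{p : V × V | ∃ h : G.Adj p.1 p.2, c.get p.1 p.2 h ∉ L p.1 p.2} : ℝ) ≤
      θ * (Fintype.card V : ℝ) ^ 2) :
    log #S ≤ (s * θ + exp (-s) * r) * (Fintype.card V : ℝ) ^ 2 +
      (∑ x, ∑ y, if G.Adj x y then log (max 1 #(L x y) : ℕ) else 0) / 2 := by
  set n : ℝ := (Fintype.card V : ℝ) with hn
  let Ls : Sym2 V → Finset (Fin r) := Sym2.lift ⟨L, hsymm⟩
  -- Exponential weights: each edge colored outside its list costs a factor exp(-s). Every coloring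
  -- in S keeps weight at least exp(-sθn²), whereas the total weight factors over the edges.
  set a := exp (-s) with ha
  have ha0 : 0 < a := exp_pos _
  have hsum : ∑ e : G.edgeSet, log (max 1 #(Ls e) : ℕ) =
      (∑ x, ∑ y, if G.Adj x y then log (max 1 #(L x y) : ℕ) else 0) / 2 := by
    have := two_mul_sum_edgeSet (G := G) (fun e => log (max 1 #(Ls e) : ℕ))
    simp only [Ls, Sym2.lift_mk] at this
    linarith
  rw [← hsum]
  have hprod : ∀ c : G.edgeSet → Fin r,
      ∏ e : G.edgeSet, (if c e ∈ Ls e then 1 else a) = a ^ #{e : G.edgeSet | c e ∉ Ls e} := by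
    intro c
    rw [prod_ite, prod_const_one, one_mul, prod_const]
  have hlow : ∀ c ∈ S, exp (-(s * θ * n ^ 2)) ≤
      ∏ e : G.edgeSet, (if c e ∈ Ls e then 1 else a) := by
    intro c hc
    have h1 : #{e : G.edgeSet | c e ∉ Ls e} ≤
        #{p : V × V | ∃ h : G.Adj p.1 p.2, c.get p.1 p.2 h ∉ L p.1 p.2} := by
      refine card_le_card_of_injOn (fun e => Quot.out e.1) ?_ ?_
      · rintro ⟨e, he⟩ hce
        simp only [coe_filter, mem_univ, true_and, Set.mem_ofPred_eq] at hce ⊢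
        have hout : s((Quot.out e).1, (Quot.out e).2) = e := Quot.out_eq e
        generalize Quot.out e = p at hout
        subst hout
        exact ⟨he, hce⟩
      · intro e _ e' _ h
        exact Subtype.ext ((Quot.out_eq e.1).symm.trans
          ((congrArg (Quot.mk _) h).trans (Quot.out_eq e'.1)))
    refine le_of_le_of_eq ?_ (hprod c).symm
    rw [ha, ← exp_nat_mul, exp_le_exp, mul_neg, neg_le_neg_iff, mul_comm, mul_assoc]
    exact mul_le_mul_of_nonneg_left 
      (le_trans (Nat.cast_le.2 (le_of_eq_of_le (by congr!) h1)) (hS c hc)) hs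
  have hup : ∑ c : G.EdgeLabeling (Fin r), ∏ e : G.edgeSet, (if c e ∈ Ls e then 1 else a) ≤
      ∏ e : G.edgeSet, ((max 1 #(Ls e) : ℕ) * exp (a * r)) := by
    have h1 := prod_univ_sum (fun _ : G.edgeSet => (univ : Finset (Fin r)))
      (fun e i => if i ∈ Ls e then 1 else a)
    rw [Fintype.piFinset_univ] at h1
    refine (le_of_eq h1.symm).trans (prod_le_prod (fun e _ => ?_) fun e _ => ?_)
    · exact sum_nonneg fun i _ => by split_ifs <;> linarith
    -- The maximum with 1 covers empty lists, for which the sum a r is still at most exp(a r).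
    · have h2 : ∑ i, (if i ∈ Ls e then 1 else a) ≤ #(Ls e) + a * r := by
        rw [sum_ite]
        simp only [sum_const, nsmul_eq_mul, mul_one, filter_mem_eq_inter, univ_inter]
        have : (#{i | i ∉ Ls e} : ℝ) ≤ r := by
          have := card_le_univ ({i | i ∉ Ls e} : Finset (Fin r))
          rw [Fintype.card_fin] at this
          exact_mod_cast this
        nlinarith
      have h3 : ((#(Ls e) : ℕ) : ℝ) ≤ (max 1 #(Ls e) : ℕ) := by exact_mod_cast le_max_right _ _
      have h4 : (1 : ℝ) ≤ (max 1 #(Ls e) : ℕ) := by exact_mod_cast le_max_left _ _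
      have h5 := add_one_le_exp (a * r)
      have h6 : 0 ≤ a * r := by positivity
      nlinarith
  have hcard : #S * exp (-(s * θ * n ^ 2)) ≤
      ∏ e : G.edgeSet, ((max 1 #(Ls e) : ℕ) * exp (a * r)) := by
    rw [← nsmul_eq_mul]
    refine (card_nsmul_le_sum S _ _ hlow).trans (le_trans ?_ hup)
    exact sum_le_sum_of_subset_of_nonneg (subset_univ S) fun c _ _ =>
      prod_nonneg fun e _ => by split_ifs <;> linarith
  have hSpos : (0 : ℝ) < #S := by exact_mod_cast hne.card_pos
  have hlog := log_le_log (by positivity) hcard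
  have hpos : ∀ e : G.edgeSet, (0 : ℝ) < (max 1 #(Ls e) : ℕ) := fun e => by
    exact_mod_cast lt_of_lt_of_le one_pos (le_max_left 1 #(Ls e))
  rw [log_mul hSpos.ne' (exp_ne_zero _), log_exp,
    log_prod fun e _ => (mul_pos (hpos e) (exp_pos _)).ne'] at hlog
  have e1 : ∑ e : G.edgeSet, log ((max 1 #(Ls e) : ℕ) * exp (a * r)) =
      ∑ e : G.edgeSet, log (max 1 #(Ls e) : ℕ) + Fintype.card G.edgeSet * (a * r) := by
    simp_rw [fun e : G.edgeSet => log_mul (hpos e).ne' (exp_ne_zero (a * r)), log_exp]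
    rw [sum_add_distrib, sum_const, card_univ, nsmul_eq_mul]
  rw [e1] at hlog
  have hE : (Fintype.card G.edgeSet : ℝ) ≤ n ^ 2 := by
    have h1 := two_mul_sum_edgeSet (G := G) (fun _ => 1)
    have h2 : ∑ x : V, ∑ y : V, (if G.Adj x y then 1 else 0 : ℝ) ≤ ∑ x : V, ∑ y : V, 1 :=
      sum_le_sum fun x _ => sum_le_sum fun y _ => by split_ifs <;> norm_num
    simp only [sum_const, card_univ, nsmul_eq_mul, mul_one] at h1 h2
    nlinarith [(Nat.cast_nonneg (Fintype.card G.edgeSet) : (0 : ℝ) ≤ _)]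
  have := mul_le_mul_of_nonneg_right hE (by positivity : 0 ≤ a * r)
  linarith

end Counting

/-! ### Stability for Mantel's theorem. -/

/-- Stability for Mantel's theorem: a graph with almost `n² / 4` edges and few triangles is almost
bipartite, and the neighborhood of some vertex is one of the classes. -/
theorem exists_neighborhood_partition {V : Type*} [Fintype V] [Nonempty V] {a : V → V → ℝ}
    (ha : ∀ x y, a x y = 0 ∨ a x y = 1) (hsymm : ∀ x y, a x y = a y x) {ε β : ℝ}
    (hε : ε ≤ 1 / 4)
    (hE : (1 / 2 - ε) * (Fintype.card V : ℝ) ^ 2 ≤ ∑ x, ∑ y, a x y)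
    (hT : ∑ x, ∑ y, ∑ z, a x y * a y z * a x z ≤ β * (Fintype.card V : ℝ) ^ 3) :
    ∃ u v, a u v = 1 ∧ ∑ x, ∑ y, a x y * (a u x * a u y + (1 - a u x) * (1 - a u y)) ≤
      (16 * β + 4 * ε) * (Fintype.card V : ℝ) ^ 2 := by
  set n : ℝ := (Fintype.card V : ℝ) with hn
  have hn0 : 0 < n := by rw [hn]; exact_mod_cast Fintype.card_pos
  set E := ∑ x, ∑ y, a x y with hEdef
  set T := ∑ x, ∑ y, ∑ z, a x y * a y z * a x z with hTdef
  have a0 : ∀ x y, 0 ≤ a x y := fun x y => by rcases ha x y with h | h <;> simp [h]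
  have a1 : ∀ x y, a x y ≤ 1 := fun x y => by rcases ha x y with h | h <;> simp [h]
  have hT0 : 0 ≤ T := sum_nonneg fun x _ => sum_nonneg fun y _ => sum_nonneg fun z _ =>
    mul_nonneg (mul_nonneg (a0 _ _) (a0 _ _)) (a0 _ _)
  have hEn : n ^ 2 / 4 ≤ E := by nlinarith [sq_nonneg n]
  have hE0 : 0 < E := lt_of_lt_of_le (by positivity) hEn
  set t : V → ℝ := fun u => ∑ x, ∑ y, a x y * (a u x * a u y) with ht
  have ht0 : ∀ u, 0 ≤ t u := fun u => sum_nonneg fun x _ => sum_nonneg fun y _ =>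
    mul_nonneg (a0 _ _) (mul_nonneg (a0 _ _) (a0 _ _))
  have htT : ∑ u, t u = T := by
    refine sum_congr rfl fun u _ => sum_congr rfl fun x _ => sum_congr rfl fun y _ => by ring
  set m : V → V → ℝ := fun u v => ∑ x, (1 - a u x) * (1 - a v x) with hm
  set Φ : V → V → ℝ := fun u v =>
    ∑ x, ∑ y, a x y * (a u x * a u y + (1 - a u x) * (1 - a u y)) with hΦ
  -- An edge inside N(u) is counted by t(u). An edge outside N(u) either lies inside N(v), counted
  -- by t(v), or has an end outside both neighborhoods, counted by m(u, v).
  have hΦle : ∀ u v, Φ u v ≤ t u + t v + 2 * n * m u v := by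
    intro u v
    have h1 : Φ u v ≤ ∑ x, ∑ y, (a x y * (a u x * a u y) + a x y * (a v x * a v y) +
        ((1 - a u x) * (1 - a v x) + (1 - a u y) * (1 - a v y))) := by
      refine sum_le_sum fun x _ => sum_le_sum fun y _ => ?_
      rcases ha x y with h | h <;> rcases ha u x with h1 | h1 <;> rcases ha u y with h2 | h2 <;>
        rcases ha v x with h3 | h3 <;> rcases ha v y with h4 | h4 <;>
        rw [h, h1, h2, h3, h4] <;> norm_num
    refine h1.trans (le_of_eq ?_)
    simp_rw [sum_add_distrib]
    simp only [ht, hm, sum_const, card_univ, nsmul_eq_mul, ← mul_sum]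
    ring
  have s1 : ∀ u, ∑ v, a u v ≤ n := fun u => by
    simpa using sum_le_card_nsmul univ (a u) 1 fun v _ => a1 u v
  have hA : ∑ u, ∑ v, a u v * t u ≤ n * T := by
    rw [← htT, mul_sum]
    refine sum_le_sum fun u _ => ?_
    rw [← sum_mul]
    exact mul_le_mul_of_nonneg_right (s1 u) (ht0 u)
  have hB : ∑ u, ∑ v, a u v * t v = ∑ u, ∑ v, a u v * t u := by
    rw [sum_comm]
    exact sum_congr rfl fun u _ => sum_congr rfl fun v _ => by rw [hsymm]
  have hCS : E ^ 2 ≤ n * ∑ u, (∑ v, a u v) ^ 2 := by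
    have := sq_sum_le_card_mul_sum_sq (s := univ) (f := fun u => ∑ v, a u v)
    simpa using this
  have hM : ∑ u, ∑ v, a u v * m u v = n * E - 2 * ∑ u, (∑ v, a u v) ^ 2 + T := by
    have e1 : ∑ u, ∑ v, ∑ x, a u v * a u x = ∑ u, (∑ v, a u v) ^ 2 := by
      refine sum_congr rfl fun u _ => ?_
      rw [sq, sum_mul_sum]
    have e2 : ∑ u, ∑ v, ∑ x, a u v * a v x = ∑ u, (∑ v, a u v) ^ 2 := by
      rw [← e1, sum_comm]
      exact sum_congr rfl fun u _ => sum_congr rfl fun v _ => sum_congr rfl fun x _ => by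
        rw [hsymm v u]
    have e3 : ∑ u, ∑ v, ∑ _x : V, a u v = n * E := by
      simp only [sum_const, card_univ, nsmul_eq_mul, ← mul_sum]
      rfl
    have e4 : ∑ u, ∑ v, a u v * m u v = ∑ u, ∑ v, ∑ x, (a u v - a u v * a u x - a u v * a v x +
        a u v * a v x * a u x) := by
      refine sum_congr rfl fun u _ => sum_congr rfl fun v _ => ?_
      rw [hm, mul_sum]
      exact sum_congr rfl fun x _ => by ring
    rw [e4]
    simp_rw [sum_add_distrib, sum_sub_distrib]
    rw [e1, e2, e3]
    ring
  -- Averaging over the edges uv: the sum is at most 4nT + 2n²E - 4nΣd(u)², where Cauchy–Schwarz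
  -- gives nΣd(u)² ≥ E², and both E ≥ n²/4 and n² - 2E ≤ 2εn² follow from the edge hypothesis.
  have hsum : ∑ u, ∑ v, a u v * Φ u v ≤ ∑ u, ∑ v, a u v * ((16 * β + 4 * ε) * n ^ 2) := by
    have h1 : ∑ u, ∑ v, a u v * Φ u v ≤
        ∑ u, ∑ v, (a u v * t u + a u v * t v + 2 * n * (a u v * m u v)) :=
      sum_le_sum fun u _ => sum_le_sum fun v _ => by
        have := mul_le_mul_of_nonneg_left (hΦle u v) (a0 u v)
        linarith
    simp_rw [sum_add_distrib, ← mul_sum] at h1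
    rw [hM, hB] at h1
    simp_rw [← sum_mul]
    have h2 : n * T ≤ β * n ^ 4 := by nlinarith
    have hβ : 0 ≤ β := by
      have : 0 ≤ β * n ^ 3 := hT0.trans hT
      exact nonneg_of_mul_nonneg_left this (by positivity)
    have h3 : β * n ^ 4 ≤ β * n ^ 2 * (4 * E) := by
      have := mul_le_mul_of_nonneg_left hEn (by positivity : 0 ≤ β * n ^ 2)
      nlinarith
    have h4 : 2 * E * (n ^ 2 - 2 * E) ≤ 2 * E * (2 * ε * n ^ 2) :=
      mul_le_mul_of_nonneg_left (by linarith) (by linarith)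
    nlinarith
  by_contra hcon
  push Not at hcon
  refine absurd hsum (not_le.2 ?_)
  have hle : ∀ u v, a u v * ((16 * β + 4 * ε) * n ^ 2) ≤ a u v * Φ u v := by
    intro u v
    rcases ha u v with h | h
    · simp [h]
    · rw [h, one_mul, one_mul]; exact (hcon u v h).le
  obtain ⟨u, hu⟩ : ∃ u, ∑ v, a u v ≠ 0 := by
    by_contra h
    push Not at h
    exact hE0.ne' (sum_eq_zero fun u _ => h u)
  obtain ⟨v, -, hv⟩ := exists_ne_zero_of_sum_ne_zero hu
  have huv : a u v = 1 := (ha u v).resolve_left hv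
  refine sum_lt_sum (fun u _ => sum_le_sum fun v _ => hle u v) ⟨u, mem_univ u, ?_⟩
  refine sum_lt_sum (fun v _ => hle u v) ⟨v, mem_univ v, ?_⟩
  rw [huv, one_mul, one_mul]
  exact hcon u v huv

open Classical in
theorem edgesInside_le {V : Type*} [Fintype V] (G : SimpleGraph V) (W : Set V) :
    (edgesInside G W : ℝ) ≤ ∑ x, ∑ y, if G.Adj x y ∧ x ∈ W ∧ y ∈ W then 1 else 0 := by
  have sub : ∀ f : V → ℝ, ∑ x : W, f x = ∑ x, if x ∈ W then f x else 0 := by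
    intro f
    rw [← sum_filter]
    exact (sum_subtype _ (fun x => by simp) f).symm
  have h1 := two_mul_sum_edgeSet (G := G.induce W) (fun _ => 1)
  have h2 : ∑ x : W, ∑ y : W, (if (G.induce W).Adj x y then 1 else 0 : ℝ) =
      ∑ x, ∑ y, if G.Adj x y ∧ x ∈ W ∧ y ∈ W then 1 else 0 := by
    simp only [SimpleGraph.comap_adj, Function.Embedding.subtype_apply]
    rw [sub fun x => ∑ y : W, if G.Adj x y then 1 else 0]
    refine sum_congr rfl fun x _ => ?_
    rw [sub fun y => if G.Adj x y then 1 else 0]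
    split_ifs with hx
    · refine sum_congr rfl fun y _ => ?_
      by_cases hy : y ∈ W <;> simp [hx, hy]
    · simp [hx]
  have h3 := h1.trans (Eq.trans (by congr!) h2)
  simp only [sum_const, card_univ, nsmul_eq_mul, mul_one] at h3
  rw [← Nat.card_eq_fintype_card] at h3
  change 2 * (edgesInside G W : ℝ) = _ at h3
  linarith [(Nat.cast_nonneg (edgesInside G W) : (0 : ℝ) ≤ _)]

/-! ### From a near-optimal template to the partition. -/

open Classical in
/-- If the lists of a template are almost as large as in the extremal case, then the pairs with a
full list form an almost bipartite graph that contains almost all the edges. -/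
theorem exists_partition_of_isTemplate {V : Type*} [Fintype V] [Nonempty V] {G : SimpleGraph V}
    {r : ℕ} (h2 : 2 ≤ r) (hr : r ≤ 26) {c : G.EdgeLabeling (Fin r)} {L : V → V → Finset (Fin r)}
    {β θ σ τ : ℝ} (hL : IsTemplate c L β θ) (hβ : β ≤ τ) (hθ : θ ≤ τ) (hτ : τ ≤ 1 / 16)
    (hσ : σ * (200 * log r) = τ) (hτ0 : 0 < τ)
    (hlow : (1 / 2 - σ) * log r * (Fintype.card V : ℝ) ^ 2 ≤
      ∑ x, ∑ y, if G.Adj x y then log (max 1 #(L x y) : ℕ) else 0)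
    (hup : ∑ x, ∑ y, listWeight r #(L x y) ≤
      (1 / 2 + σ) * log r * (Fintype.card V : ℝ) ^ 2) :
    ∃ W : Set V, W.Nonempty ∧ Wᶜ.Nonempty ∧
      (edgesInside G W : ℝ) + (edgesInside G Wᶜ : ℝ) ≤ 32 * τ * (Fintype.card V : ℝ) ^ 2 := by
  set n : ℝ := (Fintype.card V : ℝ) with hn
  have hn0 : 0 < n := by rw [hn]; exact_mod_cast Fintype.card_pos
  have hM := log_natCast_ge h2
  have hσ0 : 0 < σ := by
    by_contra h
    nlinarith
  have hστ : σ ≤ τ := by nlinarith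
  let a : V → V → ℝ := fun x y => if G.Adj x y ∧ #(L x y) = r then 1 else 0
  let part : V → V → ℝ := fun x y => if 1 ≤ #(L x y) ∧ #(L x y) < r then 1 else 0
  let exc : V → V → ℝ := fun x y => if ∃ h : G.Adj x y, c.get x y h ∉ L x y then 1 else 0
  have ha : ∀ x y, a x y = 0 ∨ a x y = 1 := fun x y => by
    simp only [a]; split_ifs <;> simp
  have hpart0 : ∀ x y, 0 ≤ part x y := fun x y => by
    simp only [part]; split_ifs <;> norm_num
  have hexc0 : ∀ x y, 0 ≤ exc x y := fun x y => by
    simp only [exc]; split_ifs <;> norm_num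
  have hcard : ∀ x y, #(L x y) ≤ r := fun x y => by simpa using card_le_univ (L x y)
  have hasymm : ∀ x y, a x y = a y x := fun x y => by
    simp only [a, G.adj_comm x y, hL.symm x y]
  have hlog : ∀ x y, 0 ≤ log (max 1 #(L x y) : ℕ) := fun x y => log_natCast_nonneg _
  have p1 : ∀ x y, (if G.Adj x y then log (max 1 #(L x y) : ℕ) else 0) + part x y / 100 ≤
      listWeight r #(L x y) := by
    intro x y
    have h1 : (if G.Adj x y then log (max 1 #(L x y) : ℕ) else 0) ≤ log (max 1 #(L x y) : ℕ) := by
      split_ifs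
      · exact le_rfl
      · exact hlog x y
    refine (add_le_add_left h1 _).trans ?_
    rcases Nat.eq_zero_or_pos #(L x y) with h | h
    · have : part x y = 0 := if_neg (by omega)
      simp [this, h]
    · rw [max_eq_right h]
      rcases (hcard x y).lt_or_eq with h' | h'
      · rw [listWeight_of_lt h h']
        simp only [part]
        rw [if_pos ⟨h, h'⟩]
      · have : listWeight r r = log r := by
          rw [listWeight, if_neg (by omega), if_pos rfl]
        simp [part, h', this]
  have p2 : ∀ x y, (if G.Adj x y then log (max 1 #(L x y) : ℕ) else 0) ≤
      log r * (a x y + part x y) := by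
    intro x y
    split_ifs with hadj
    · rcases Nat.eq_zero_or_pos #(L x y) with h | h
      · simp only [h, a]
        have := hpart0 x y
        have h0 : (0 : ℕ) ≠ r := by omega
        simp only [h0, and_false, if_false]
        simp only [zero_le, sup_of_le_left, Nat.cast_one, log_one]
        positivity
      · rw [max_eq_right h]
        have hle : log #(L x y) ≤ log r :=
          log_le_log (by exact_mod_cast h) (by exact_mod_cast hcard x y)
        have : a x y + part x y = 1 := by
          rcases (hcard x y).lt_or_eq with h' | h'
          · have h1 : part x y = 1 := if_pos ⟨h, h'⟩
            simp [a, h1, h'.ne]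
          · simp [a, part, h', hadj]
        rw [this, mul_one]; exact hle
    · have h1 := hpart0 x y
      have h2 : 0 ≤ a x y := by rcases ha x y with h | h <;> rw [h]; norm_num
      positivity
  have s1 := sum_le_sum fun x (_ : x ∈ univ) => sum_le_sum fun y (_ : y ∈ univ) => p1 x y
  simp_rw [sum_add_distrib, ← sum_div] at s1
  have s2 := sum_le_sum fun x (_ : x ∈ univ) => sum_le_sum fun y (_ : y ∈ univ) => p2 x y
  simp_rw [← mul_sum, sum_add_distrib] at s2
  -- The two bounds differ by 2σ log r · n², and each partial pair costs 1/100 of it; this is the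
  -- origin of 200 log r in the relation between σ and τ.
  have hpart : ∑ x, ∑ y, part x y ≤ τ * n ^ 2 := by
    rw [← hσ]; linarith
  have hE : (1 / 2 - (σ + τ)) * n ^ 2 ≤ ∑ x, ∑ y, a x y := by
    have h3 : log r * ((1 / 2 - σ) * n ^ 2) ≤
        log r * (∑ x, ∑ y, a x y + ∑ x, ∑ y, part x y) := by linarith
    have := le_of_mul_le_mul_left h3 (by linarith)
    linarith
  have hT : ∑ x, ∑ y, ∑ z, a x y * a y z * a x z ≤ β * n ^ 3 := by
    refine le_trans ?_ hL.bad
    refine sum_le_sum fun x _ => sum_le_sum fun y _ => sum_le_sum fun z _ => ?_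
    have hfull : ∀ x y, a x y = 1 → ∀ i, i ∈ L x y := by
      intro x y h i
      have h' : #(L x y) = r := by
        by_contra h'
        simp [a, h'] at h
      have : L x y = univ := by rw [← card_eq_iff_eq_univ, Fintype.card_fin, h']
      rw [this]; exact mem_univ i
    split_ifs with hf
    · rcases ha x y with h | h
      · simp [h]
      rcases ha y z with h' | h'
      · simp [h']
      rcases ha x z with h'' | h''
      · simp [h'']
      have := hf ⟨0, by omega⟩ ⟨1, by omega⟩ (hfull x y h _) (hfull y z h' _) (hfull x z h'' _)
      simp at this
    · rcases ha x y with h | h <;> rcases ha y z with h' | h' <;> rcases ha x z with h'' | h'' <;>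
        rw [h, h', h''] <;> norm_num
  obtain ⟨u, v, huv, hΦ⟩ := exists_neighborhood_partition ha hasymm (by linarith) hE hT
  have hexc : ∑ x, ∑ y, exc x y ≤ θ * n ^ 2 := by
    refine le_trans (le_of_eq ?_) hL.exc
    rw [card_filter, Nat.cast_sum, Fintype.sum_prod_type]
    exact sum_congr rfl fun x _ => sum_congr rfl fun y _ => by simp [exc]
  obtain ⟨W, hW⟩ : ∃ W : Set V, ∀ x, x ∈ W ↔ a u x = 1 := ⟨{x | a u x = 1}, fun x => Iff.rfl⟩
  refine ⟨W, ⟨v, (hW v).2 huv⟩, ⟨u, ?_⟩, ?_⟩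
  -- No vertex is its own neighbor, so u lies outside N(u), while v lies inside.
  · simp [hW, a]
  have h1 : (edgesInside G W : ℝ) ≤ ∑ x, ∑ y, if G.Adj x y ∧ x ∈ W ∧ y ∈ W then 1 else 0 := by
    convert! edgesInside_le G W
  have h3 : (edgesInside G Wᶜ : ℝ) ≤ ∑ x, ∑ y, if G.Adj x y ∧ x ∈ Wᶜ ∧ y ∈ Wᶜ then 1 else 0 := by
    convert! edgesInside_le G Wᶜ
  -- An edge inside a class has a full list and is counted by Φ, or has a partial list, or has an
  -- empty list and is exceptional.
  have hpt : ∀ x y, (if G.Adj x y ∧ x ∈ W ∧ y ∈ W then 1 else 0 : ℝ) +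
      (if G.Adj x y ∧ x ∈ Wᶜ ∧ y ∈ Wᶜ then 1 else 0) ≤
      a x y * (a u x * a u y + (1 - a u x) * (1 - a u y)) + part x y + exc x y := by
    intro x y
    have hg0 : 0 ≤ a u x * a u y + (1 - a u x) * (1 - a u y) := by
      rcases ha u x with h | h <;> rcases ha u y with h' | h' <;> rw [h, h'] <;> norm_num
    have hle : (if G.Adj x y ∧ x ∈ W ∧ y ∈ W then 1 else 0 : ℝ) +
        (if G.Adj x y ∧ x ∈ Wᶜ ∧ y ∈ Wᶜ then 1 else 0) =
        if G.Adj x y then a u x * a u y + (1 - a u x) * (1 - a u y) else 0 := by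
      simp only [Set.mem_compl_iff, hW]
      rcases ha u x with h | h <;> rcases ha u y with h' | h' <;> simp [h, h']
    have hg1 : a u x * a u y + (1 - a u x) * (1 - a u y) ≤ 1 := by
      rcases ha u x with h | h <;> rcases ha u y with h' | h' <;> rw [h, h'] <;> norm_num
    rw [hle]
    have k1 := hpart0 x y
    have k2 := hexc0 x y
    split_ifs with hadj
    · rcases Nat.eq_zero_or_pos #(L x y) with h | h
      · have : exc x y = 1 := by
          simp only [exc]
          rw [if_pos ⟨hadj, by rw [card_eq_zero.1 h]; simp⟩]
        rcases ha x y with h' | h' <;> rw [this, h'] <;> linarith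
      · rcases (hcard x y).lt_or_eq with h' | h'
        · have : part x y = 1 := if_pos ⟨h, h'⟩
          rcases ha x y with h' | h' <;> rw [this, h'] <;> linarith
        · have : a x y = 1 := if_pos ⟨hadj, h'⟩
          rw [this]; linarith
    · rcases ha x y with h' | h' <;> rw [h'] <;> linarith
  have hs := sum_le_sum fun x (_ : x ∈ univ) => sum_le_sum fun y (_ : y ∈ univ) => hpt x y
  simp_rw [sum_add_distrib] at hs
  rw [← hn] at hΦ
  have hc : (16 * β + 4 * (σ + τ) + τ + θ) * n ^ 2 ≤ 32 * τ * n ^ 2 :=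
    mul_le_mul_of_nonneg_right (by linarith) (sq_nonneg n)
  linarith

open Classical in
/-- A graph with many pattern-free colorings has a template, chosen from few, whose lists admit
many colorings. -/
theorem exists_isTemplate_of_le_numPatternFree {r : ℕ} {β θ s : ℝ} (hβ : 0 < β) (hθ : 0 < θ)
    (hs : 0 ≤ s) :
    ∃ D : ℝ, 0 ≤ D ∧ ∀ (V : Type*) [Fintype V] [Nonempty V] (G : SimpleGraph V),
      0 < numPatternFree r triangleTwo G →
      ∃ (c : G.EdgeLabeling (Fin r)) (L : V → V → Finset (Fin r)), IsTemplate c L β θ ∧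
        log (numPatternFree r triangleTwo G) ≤ D * Fintype.card V +
          (s * θ + exp (-s) * r) * (Fintype.card V : ℝ) ^ 2 +
          (∑ x, ∑ y, if G.Adj x y then log (max 1 #(L x y) : ℕ) else 0) / 2 := by
  obtain ⟨K, hK⟩ := exists_isTemplate r hβ hθ
  set C : ℝ := log (Fintype.card (Fin K → Fin K → Finset (Fin r))) with hC
  have hC0 : 0 ≤ C := log_natCast_nonneg _
  have hK0 : 0 ≤ log K := log_natCast_nonneg _
  refine ⟨log K + C, by positivity, fun V _ _ G hpos => ?_⟩
  have hfree : ∀ c : {c : G.EdgeLabeling (Fin r) // IsPatternFree triangleTwo c},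
      ∃ t : (V → Fin K) × (Fin K → Fin K → Finset (Fin r)),
        IsTemplate c.1 (fun x y => t.2 (t.1 x) (t.1 y)) β θ := fun c => by
    obtain ⟨P, Λ, h⟩ := hK V G c.1 c.2
    exact ⟨(P, Λ), h⟩
  choose f hf using hfree
  have hcardN : numPatternFree r triangleTwo G =
      #(univ : Finset {c : G.EdgeLabeling (Fin r) // IsPatternFree triangleTwo c}) := by
    rw [numPatternFree, Nat.card_eq_fintype_card, card_univ]
  set N : ℝ := (numPatternFree r triangleTwo G : ℝ) with hN
  have hN0 : 0 < N := by rw [hN]; exact_mod_cast hpos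
  have hne : (univ : Finset {c : G.EdgeLabeling (Fin r) // IsPatternFree triangleTwo c}).Nonempty :=
    card_pos.1 (hcardN ▸ hpos)
  obtain ⟨c₀, -⟩ := hne
  set B : ℕ := #(univ : Finset ((V → Fin K) × (Fin K → Fin K → Finset (Fin r)))) with hB
  have hBpos : (0 : ℝ) < B := by
    rw [hB]; exact_mod_cast card_pos.2 ⟨f c₀, mem_univ _⟩
  -- Pigeonhole: some template serves at least the average number of colorings. There are K^|V|
  -- partitions and boundedly many Λ, which costs the linear term D |V|.
  obtain ⟨t, -, ht⟩ := exists_le_card_fiber_of_nsmul_le_card_of_maps_to (s := univ) (t := univ)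
    (f := f) (b := N / B) (fun c _ => mem_univ (f c)) ⟨f c₀, mem_univ (f c₀)⟩ (by
      rw [nsmul_eq_mul, ← hcardN, ← hB, mul_div_cancel₀ _ hBpos.ne'])
  let S : Finset (G.EdgeLabeling (Fin r)) :=
    ({c | f c = t} : Finset {c : G.EdgeLabeling (Fin r) // IsPatternFree triangleTwo c}).map
      (Function.Embedding.subtype _)
  have hScard : N / B ≤ #S := by rw [card_map]; exact ht
  have hSpos : (0 : ℝ) < #S := lt_of_lt_of_le (by positivity) hScard
  have hSne : S.Nonempty := card_pos.1 (by exact_mod_cast hSpos)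
  have hS : ∀ c ∈ S, IsTemplate c (fun x y => t.2 (t.1 x) (t.1 y)) β θ := by
    intro c hc
    simp only [S, mem_map, mem_filter, mem_univ, true_and, Function.Embedding.subtype_apply] at hc
    obtain ⟨c', h1, rfl⟩ := hc
    have := hf c'
    rwa [h1] at this
  obtain ⟨c, hc⟩ := hSne
  refine ⟨c, _, hS c hc, ?_⟩
  have h1 := log_card_colorings_le (hS c hc).symm hs S ⟨c, hc⟩ fun c hc => (hS c hc).exc
  have h2 : log N ≤ log B + log #S := by
    rw [← log_mul hBpos.ne' hSpos.ne']
    rw [div_le_iff₀ hBpos] at hScard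
    exact log_le_log hN0 (by linarith)
  have h3 : log B ≤ (log K + C) * Fintype.card V := by
    have hVpos : (1 : ℝ) ≤ Fintype.card V := by exact_mod_cast Fintype.card_pos (α := V)
    have hB' : (B : ℝ) = (K : ℝ) ^ Fintype.card V *
        (Fintype.card (Fin K → Fin K → Finset (Fin r)) : ℕ) := by
      rw [hB, card_univ, Fintype.card_prod, Fintype.card_fun (α := V), Fintype.card_fin]
      push_cast; rfl
    rw [hB'] at hBpos ⊢
    rw [log_mul (left_ne_zero_of_mul hBpos.ne') (right_ne_zero_of_mul hBpos.ne'), log_pow]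
    nlinarith
  linarith

theorem extremalNumber_triangle_ge (n : ℕ) :
    (n : ℝ) ^ 2 / 4 - 1 ≤ SimpleGraph.extremalNumber n triangle := by
  have h := SimpleGraph.extremalNumber_top (n := n) (α := Fin 3)
  rw [Fintype.card_fin, SimpleGraph.card_edgeFinset_turanGraph] at h
  have h1 : n ^ 2 ≤ 4 * SimpleGraph.extremalNumber n triangle + 4 := by
    rw [h]
    have h3 : (n % 2) ^ 2 ≤ 1 := by
      rcases Nat.mod_two_eq_zero_or_one n with h | h <;> rw [h] <;> norm_num
    norm_num
    omega
  have h2 : (n : ℝ) ^ 2 ≤ 4 * SimpleGraph.extremalNumber n triangle + 4 := by exact_mod_cast h1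
  linarith

end EdgePattern

/-! ### Choice of constants and conclusion. -/

open EdgePattern Real in
theorem lemma1p2 (r : ℕ) (hr₂ : 2 ≤ r) (hr₂₆ : r ≤ 26) (δ : ℝ) (hδ : 0 < δ) :
    ∃ n₀ : ℕ, ∀ n : ℕ, n₀ ≤ n →
      ∀ (V : Type*) [Fintype V] (G : SimpleGraph V), Fintype.card V = n →
        r ^ SimpleGraph.extremalNumber n EdgePattern.triangle ≤
            EdgePattern.numPatternFree r EdgePattern.triangleTwo G →
          ∃ W₁ W₂ : Set V, W₁.Nonempty ∧ W₂.Nonempty ∧ Disjoint W₁ W₂ ∧ W₁ ∪ W₂ = Set.univ ∧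
            (EdgePattern.edgesInside G W₁ : ℝ) + (EdgePattern.edgesInside G W₂ : ℝ) ≤
              δ * (n : ℝ) ^ 2 := by
  set M := log r with hMdef
  have hM : 1 / 2 ≤ M := log_natCast_ge hr₂
  have hM0 : 0 < M := by linarith
  have hr0 : (0 : ℝ) < r := by exact_mod_cast (by omega : 0 < r)
  set τ : ℝ := min δ 1 / 32 with hτ
  have hτ0 : 0 < τ := by positivity
  have hτ1 : τ ≤ 1 / 16 := by have := min_le_right δ 1; rw [hτ]; linarith
  have hτδ : 32 * τ ≤ δ := by have := min_le_left δ 1; rw [hτ]; linarith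
  set σ : ℝ := τ / (200 * M) with hσ
  have hσ0 : 0 < σ := by positivity
  have hστ : σ * (200 * M) = τ := by rw [hσ]; field_simp
  -- The sample size makes the loss q² / (q(q - 1)) from the diagonal cost at most σ/2; the choice
  -- of β leaves the other σ/2 for the bad triples.
  obtain ⟨q, hq⟩ := exists_nat_ge (1 / σ + 3)
  have hq3 : (3 : ℝ) ≤ q := by have : 0 < 1 / σ := by positivity
                               linarith
  have hqσ : 1 ≤ σ * (q - 1) := by
    have h1 : 1 / σ ≤ (q : ℝ) - 1 := by linarith
    rw [div_le_iff₀ hσ0] at h1; linarith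
  set β : ℝ := min τ (σ / (2 * q ^ 5)) with hβ
  have hβ0 : 0 < β := by positivity
  have hβq : q ^ 5 * β ≤ σ / 2 := by
    calc (q : ℝ) ^ 5 * β ≤ q ^ 5 * (σ / (2 * q ^ 5)) := by gcongr; exact min_le_right _ _
      _ = σ / 2 := by field_simp
  -- First s makes exp(-s) r small, then θ makes sθ small; each takes σM/8 of the error.
  set s : ℝ := max 1 (log (8 * r / (σ * M))) with hs
  have hs1 : 1 ≤ s := le_max_left _ _
  have hsr : exp (-s) * r ≤ σ * M / 8 := by
    have h1 : 8 * r / (σ * M) ≤ exp s := by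
      rw [← log_le_iff_le_exp (by positivity)]; exact le_max_right _ _
    rw [exp_neg, inv_mul_le_iff₀ (exp_pos s)]
    rw [div_le_iff₀ (by positivity)] at h1
    linarith
  set θ : ℝ := min τ (σ * M / (8 * s)) with hθ
  have hθ0 : 0 < θ := by positivity
  have hsθ : s * θ ≤ σ * M / 8 := by
    calc s * θ ≤ s * (σ * M / (8 * s)) := by gcongr; exact min_le_right _ _
      _ = σ * M / 8 := by field_simp
  obtain ⟨D, hD0, hD⟩ := exists_isTemplate_of_le_numPatternFree (r := r) hβ0 hθ0
    (by linarith : 0 ≤ s)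
  obtain ⟨n₀, hn₀⟩ := exists_nat_ge ((2 * M + 2 * D) / (σ * M / 2))
  refine ⟨n₀ + 1, fun n hn V _ G hcard hcol => ?_⟩
  have hnpos : 0 < n := by omega
  have : Nonempty V := Fintype.card_pos_iff.1 (hcard ▸ hnpos)
  have hN : 0 < numPatternFree r triangleTwo G := lt_of_lt_of_le (by positivity) hcol
  obtain ⟨c, L, hL, hlog⟩ := hD V G hN
  rw [hcard] at hlog
  have hn1 : (1 : ℝ) ≤ n := by exact_mod_cast hnpos
  have hex : ((n : ℝ) ^ 2 / 4 - 1) * M ≤ log (numPatternFree r triangleTwo G) := by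
    refine (mul_le_mul_of_nonneg_right (extremalNumber_triangle_ge n) hM0.le).trans ?_
    rw [hMdef, ← log_pow]
    exact log_le_log (by positivity) (by exact_mod_cast hcol)
  have hlarge : 2 * M + 2 * D * n ≤ σ * M / 2 * n ^ 2 := by
    have h1 : (2 * M + 2 * D) / (σ * M / 2) ≤ n :=
      hn₀.trans (by exact_mod_cast (by omega : n₀ ≤ n))
    rw [div_le_iff₀ (by positivity)] at h1
    nlinarith
  have hlow : (1 / 2 - σ) * M * (n : ℝ) ^ 2 ≤
      ∑ x, ∑ y, open Classical in if G.Adj x y then log (max 1 (L x y).card : ℕ) else 0 := by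
    have h1 : (s * θ + exp (-s) * r) * (n : ℝ) ^ 2 ≤ σ * M / 4 * n ^ 2 := by
      gcongr; linarith
    linarith
  have hup : ∑ x, ∑ y, listWeight r (L x y).card ≤ (1 / 2 + σ) * M * (n : ℝ) ^ 2 := by
    have h1 := sum_listWeight_le_of_few_bad hr₂ hr₂₆ hL.symm (q := q) (by exact_mod_cast hq3)
      hL.bad
    rw [hcard, ← hMdef] at h1
    have h2 : (q : ℝ) ^ 2 / 2 + q ^ 5 * β ≤ (1 / 2 + σ) * (q * (q - 1)) := by nlinarith
    have h3 := mul_le_mul_of_nonneg_right h2 (by positivity : 0 ≤ M * (n : ℝ) ^ 2)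
    refine le_of_mul_le_mul_left ?_ (by nlinarith : (0 : ℝ) < q * (q - 1))
    linarith
  rw [← hcard] at hlow hup
  obtain ⟨W, h1, h2, h3⟩ := exists_partition_of_isTemplate hr₂ hr₂₆ hL (min_le_left _ _)
    (min_le_left _ _) hτ1 hστ hτ0 hlow hup
  refine ⟨W, Wᶜ, h1, h2, disjoint_compl_right, Set.union_compl_self W, h3.trans ?_⟩
  rw [hcard]
  gcongr
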